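/- Let $M$ be a compact connected smooth manifold (without boundary), of dimension $n+1$ with $n\ge 0$, and let $\mathcal V$ be a transversally orientable smooth codimension-one foliation on $M$. "Compact leaf" means a leaf that is compact in its leaf topology. For a compact leaf $L$ of $\mathcal V$ and a neighborhood $U$ of $L$ in $M$, consider the following two options: (i) the leaves of $\mathcal V$ intersecting $U\smallsetminus L$ are all noncompact; (ii) the leaves of $\mathcal V$ intersecting $U\smallsetminus L$ are all compact, and some neighborhood of $L$ in $M$ forming a union of compact leaves of $\mathcal V$ may be diffeomorphically identified with $\mathbb R\times L$ so as to make $\mathcal V$ the $L$ factor foliation (that is, so that the leaves of $\mathcal V$ contained in that neighborhood correspond to the sets $\{t\}\times L$, $t\in\mathbb R$). Assume that $\mathcal V$ has the dichotomy property: every compact leaf $L$ of $\mathcal V$ has a neighborhood $U$ in $M$ for which (i) or (ii) holds. Assume also that some compact leaf $L$ of $\mathcal V$ realizes option (ii), for some neighborhood $U$ of $L$ in $M$. Then the leaves of $\mathcal V$ are all compact, and they are precisely the fibres of a smooth locally trivial bundle projection $M\to S^1$. -/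

import Mathlib

open Set Topology
open scoped Manifold ContDiff

universe u

/-- A (smooth) codimension-one foliation of an `(n+1)`-dimensional smooth manifold `M`, given by an
atlas of smooth foliated charts with values in `ℝⁿ × ℝ`. The plaques are the level sets of the
second (transverse) coordinate; the changes of charts are locally of the form
`(p, t) ↦ (g (p, t), h t)`. -/
structure CodimOneFoliation (n : ℕ) (M : Type u) [TopologicalSpace M]
    [ChartedSpace (EuclideanSpace ℝ (Fin (n + 1))) M] where
  /-- The foliated charts. -/
  atlas : Set (OpenPartialHomeomorph M (EuclideanSpace ℝ (Fin n) × ℝ))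
  covers : ∀ x : M, ∃ e ∈ atlas, x ∈ e.source
  smooth : ∀ e ∈ atlas,
    ContMDiffOn (𝓡 (n + 1)) 𝓘(ℝ, EuclideanSpace ℝ (Fin n) × ℝ) ∞ e e.source
  smooth_symm : ∀ e ∈ atlas,
    ContMDiffOn 𝓘(ℝ, EuclideanSpace ℝ (Fin n) × ℝ) (𝓡 (n + 1)) ∞ e.symm e.target
  compatible : ∀ e ∈ atlas, ∀ e' ∈ atlas, ∀ x ∈ e.source ∩ e'.source, ∃ U ∈ 𝓝 x,
    ∀ y ∈ U ∩ (e.source ∩ e'.source), ∀ z ∈ U ∩ (e.source ∩ e'.source),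
      (e y).2 = (e z).2 → (e' y).2 = (e' z).2

namespace CodimOneFoliation

variable {n : ℕ} {M : Type u} [TopologicalSpace M]
  [ChartedSpace (EuclideanSpace ℝ (Fin (n + 1))) M]

/-- The leaf topology on `M`: it is generated by the open sets of `M` and the plaques of the
foliated charts. -/
@[reducible] def leafTopology (V : CodimOneFoliation n M) : TopologicalSpace M :=
  TopologicalSpace.generateFrom
    {s | IsOpen s ∨ ∃ e ∈ V.atlas, ∃ c : ℝ, s = {x | x ∈ e.source ∧ (e x).2 = c}}

/-- The leaf through `x`: the connected component of `x` in the leaf topology. -/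
def leaf (V : CodimOneFoliation n M) (x : M) : Set M :=
  @connectedComponent M V.leafTopology x

/-- `L` is a leaf of `V`. -/
def IsLeaf (V : CodimOneFoliation n M) (L : Set M) : Prop :=
  ∃ x, L = V.leaf x

/-- `L` is a compact leaf of `V`, that is, a leaf compact in its leaf topology. -/
def IsCompactLeaf (V : CodimOneFoliation n M) (L : Set M) : Prop :=
  V.IsLeaf L ∧ @IsCompact M V.leafTopology L

/-- `e` is a foliated chart of `V` (an element of the maximal foliated atlas): a smooth chart of `M`
whose changes of charts with the elements of `V.atlas` locally preserve plaques. -/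
structure IsFoliatedChart (V : CodimOneFoliation n M)
    (e : OpenPartialHomeomorph M (EuclideanSpace ℝ (Fin n) × ℝ)) : Prop where
  smooth : ContMDiffOn (𝓡 (n + 1)) 𝓘(ℝ, EuclideanSpace ℝ (Fin n) × ℝ) ∞ e e.source
  smooth_symm : ContMDiffOn 𝓘(ℝ, EuclideanSpace ℝ (Fin n) × ℝ) (𝓡 (n + 1)) ∞ e.symm e.target
  compatible : ∀ e' ∈ V.atlas, ∀ x ∈ e.source ∩ e'.source, ∃ U ∈ 𝓝 x,
    ∀ y ∈ U ∩ (e.source ∩ e'.source), ∀ z ∈ U ∩ (e.source ∩ e'.source),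
      ((e y).2 = (e z).2 ↔ (e' y).2 = (e' z).2)

/-- `V` is transversally orientable: `M` is covered by foliated charts of `V` whose changes of
charts, locally of the form `(p, t) ↦ (g (p, t), h t)`, satisfy `h' > 0`. Equivalently, the normal
line bundle of `V` is orientable. -/
def TransversallyOrientable (V : CodimOneFoliation n M) : Prop :=
  ∃ A : Set (OpenPartialHomeomorph M (EuclideanSpace ℝ (Fin n) × ℝ)),
    (∀ e ∈ A, V.IsFoliatedChart e) ∧ (∀ x : M, ∃ e ∈ A, x ∈ e.source) ∧
    ∀ e ∈ A, ∀ e' ∈ A, ∀ x ∈ e.source ∩ e'.source,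
      0 < deriv (fun t : ℝ => (e' (e.symm ((e x).1, t))).2) (e x).2

/-- Some neighbourhood `N` of `L` in `M` forming a union of compact leaves of `V` may be
diffeomorphically identified with `ℝ × L` so as to make `V` the `L` factor foliation. The
identification is normalized to send `(0, p)` to `p`; since this makes the inclusion `L → M` a
smooth embedding, the smooth structure of `L` used here is the one of `L` as a leaf. -/
def HasProductNeighborhood (V : CodimOneFoliation n M) (L : Set M) : Prop :=
  ∃ (_ : ChartedSpace (EuclideanSpace ℝ (Fin n)) L) (_ : IsManifold (𝓡 n) ∞ L)
    (N : TopologicalSpace.Opens M)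
    (Ψ : (ℝ × L) ≃ₘ^∞⟮𝓘(ℝ, ℝ).prod (𝓡 n), 𝓡 (n + 1)⟯ N),
    (∀ p : L, (Ψ (0, p) : M) = p) ∧
    ∀ t : ℝ, V.IsCompactLeaf (range fun p : L => (Ψ (t, p) : M))

/-- Option (i) for a compact leaf `L` and its neighbourhood `U`: the leaves intersecting `U \ L` are
all noncompact. -/
def OptionOne (V : CodimOneFoliation n M) (L U : Set M) : Prop :=
  ∀ L', V.IsLeaf L' → (L' ∩ (U \ L)).Nonempty → ¬ V.IsCompactLeaf L'

/-- Option (ii) for a compact leaf `L` and its neighbourhood `U`: the leaves intersecting `U \ L`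
are all compact, and `L` has a product-like neighbourhood made up of compact leaves. -/
def OptionTwo (V : CodimOneFoliation n M) (L U : Set M) : Prop :=
  (∀ L', V.IsLeaf L' → (L' ∩ (U \ L)).Nonempty → V.IsCompactLeaf L') ∧
    V.HasProductNeighborhood L

/-- The dichotomy property. -/
def DichotomyProperty (V : CodimOneFoliation n M) : Prop :=
  ∀ L, V.IsCompactLeaf L → ∃ U ∈ 𝓝ˢ L, V.OptionOne L U ∨ V.OptionTwo L U

end CodimOneFoliation

/-- `π : M → S¹` is the projection of a smooth (locally trivial) fibre bundle over the circle with
`n`-dimensional fibre, where `dim M = n + 1`. -/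
def IsSmoothBundleOverCircle (n : ℕ) {M : Type u} [TopologicalSpace M]
    [ChartedSpace (EuclideanSpace ℝ (Fin (n + 1))) M] (π : M → Circle) : Prop :=
  ContMDiff (𝓡 (n + 1)) (𝓡 1) ∞ π ∧
  ∃ (F : Type u) (_ : TopologicalSpace F) (_ : ChartedSpace (EuclideanSpace ℝ (Fin n)) F)
    (_ : IsManifold (𝓡 n) ∞ F),
    ∀ b : Circle, ∃ e : Bundle.Trivialization F π, b ∈ e.baseSet ∧
      ContMDiffOn (𝓡 (n + 1)) ((𝓡 1).prod (𝓡 n)) ∞ e e.source ∧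
      ContMDiffOn ((𝓡 1).prod (𝓡 n)) (𝓡 (n + 1)) ∞ e.toOpenPartialHomeomorph.symm e.target

/-! Fix the compact leaf `F` given by option (ii), and let `P` be the union of all open sets of `M`
identified with `ℝ × F` so that the slices are compact leaves (`LeafProduct`). `P` is open and
saturated, and the first half of the proof shows `P = M`. Let `G` be a component of `P`. Each gap
that `G` cuts out of a compact transversal meets every leaf of `G` (`leaf_inter_gap`), in particular
one fixed compact leaf, which meets the transversal finitely often. So the frontier of `G` meets the
transversal in finitely many points, and compactness of `M` makes the frontier leaves compact. The
dichotomy property then applies to such a leaf. Option (i) is impossible because compact leaves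
accumulate there. Under (ii) the new product shares a leaf with one modelled on `F`, so it can be
modelled on `F` too. Hence `closure G ⊆ P`, and `G` is clopen, so `G = M`.

For the second half, transverse orientability lets all products be oriented coherently. Each product
gives a circle-valued function, constant on leaves, that winds once as the height goes from `0` to
`1` and equals `1` elsewhere. The product `f` of finitely many of these has positive derivative
transversally. On the leaf space `Q`, which is compact, connected and Hausdorff, `f` induces a local
homeomorphism to the circle, hence a finite covering. So `Q` is a circle and `f = g ^ m`, where the
fibres of `g` are exactly the leaves. Locally `g` is a smooth root of `f`, and the products
trivialize it. -/

/-- A point of the domain of a chart with values in a product has arbitrarily small closed boxes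
around it. -/
theorem OpenPartialHomeomorph.exists_box {M E : Type*} [TopologicalSpace M]
    [NormedAddCommGroup E] {e : OpenPartialHomeomorph M (E × ℝ)} {x : M}
    (hx : x ∈ e.source) {O : Set M} (hO : O ∈ 𝓝 x) :
    ∃ r > 0, ∀ p ∈ Metric.closedBall (e x).1 r, ∀ s ∈ Metric.closedBall (e x).2 r,
      (p, s) ∈ e.target ∧ e.symm (p, s) ∈ O := by
  have h1 : e.target ∩ e.symm ⁻¹' O ∈ 𝓝 (e x) := by
    refine Filter.inter_mem (e.open_target.mem_nhds (e.map_source hx)) ?_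
    refine (e.continuousAt_symm (e.map_source hx)) ?_
    rwa [e.left_inv hx]
  obtain ⟨r, hr, h⟩ := Metric.nhds_basis_closedBall.mem_iff.1 h1
  refine ⟨r, hr, fun p hp s hs => h ?_⟩
  rw [← closedBall_prod_same]
  exact ⟨hp, hs⟩

namespace CodimOneFoliation

variable {n : ℕ} {M : Type u} [TopologicalSpace M]
  [ChartedSpace (EuclideanSpace ℝ (Fin (n + 1))) M]

/-! ### The leaf topology -/

theorem isOpen_leafTopology (V : CodimOneFoliation n M) {s : Set M} (hs : IsOpen s) :
    IsOpen[V.leafTopology] s :=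
  TopologicalSpace.isOpen_generateFrom_of_mem (Or.inl hs)

theorem isOpen_plaque (V : CodimOneFoliation n M)
    {e : OpenPartialHomeomorph M (EuclideanSpace ℝ (Fin n) × ℝ)} (he : e ∈ V.atlas) (c : ℝ) :
    IsOpen[V.leafTopology] {x | x ∈ e.source ∧ (e x).2 = c} :=
  TopologicalSpace.isOpen_generateFrom_of_mem (Or.inr ⟨e, he, c, rfl⟩)

theorem continuous_id_leafTopology (V : CodimOneFoliation n M) :
    @Continuous M M V.leafTopology _ id :=
  @Continuous.mk M M V.leafTopology _ _ fun _ hs => V.isOpen_leafTopology hs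

theorem isCompact_of_leafTopology (V : CodimOneFoliation n M) {s : Set M}
    (hs : @IsCompact M V.leafTopology s) : IsCompact s := by
  have := @IsCompact.image M M V.leafTopology _ s id hs V.continuous_id_leafTopology
  rwa [image_id] at this

theorem isPreconnected_of_leafTopology (V : CodimOneFoliation n M) {s : Set M}
    (hs : @IsPreconnected M V.leafTopology s) : IsPreconnected s := by
  have := @IsPreconnected.image M M V.leafTopology _ s hs id
    (@Continuous.continuousOn M M V.leafTopology _ id s V.continuous_id_leafTopology)
  rwa [image_id] at this

theorem continuous_leafTopology (V : CodimOneFoliation n M) {X : Type*} [TopologicalSpace X]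
    {g : X → M} (hg : Continuous g)
    (h : ∀ e ∈ V.atlas, ∀ x, g x ∈ e.source → ∀ᶠ y in 𝓝 x, (e (g y)).2 = (e (g x)).2) :
    @Continuous X M _ V.leafTopology g := by
  rw [continuous_generateFrom_iff]
  rintro s (hs | ⟨e, he, c, rfl⟩)
  · exact hs.preimage hg
  · rw [isOpen_iff_mem_nhds]
    rintro x ⟨hx, rfl⟩
    filter_upwards [h e he x hx, (e.open_source.preimage hg).mem_nhds hx] with y hy hys
    exact ⟨hys, hy⟩

/-! ### Leaves -/

theorem mem_leaf (V : CodimOneFoliation n M) (x : M) : x ∈ V.leaf x :=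
  @mem_connectedComponent M V.leafTopology x

theorem leaf_eq (V : CodimOneFoliation n M) {x y : M} (h : y ∈ V.leaf x) : V.leaf x = V.leaf y :=
  @connectedComponent_eq M V.leafTopology x y h

theorem IsLeaf.eq_leaf {V : CodimOneFoliation n M} {L : Set M} (hL : V.IsLeaf L) {x : M}
    (hx : x ∈ L) : L = V.leaf x := by
  obtain ⟨y, rfl⟩ := hL
  exact V.leaf_eq hx

theorem isPreconnected_leaf (V : CodimOneFoliation n M) (x : M) : IsPreconnected (V.leaf x) :=
  V.isPreconnected_of_leafTopology (@isPreconnected_connectedComponent M V.leafTopology x)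

theorem leaf_subset_of_isClopen (V : CodimOneFoliation n M) {s : Set M} {x : M}
    (hs : @IsClopen M V.leafTopology s) (hx : x ∈ s) : V.leaf x ⊆ s :=
  @IsClopen.connectedComponent_subset M V.leafTopology s x hs hx

theorem isClosed_leaf (V : CodimOneFoliation n M) (x : M) :
    IsClosed[V.leafTopology] (V.leaf x) :=
  @isClosed_connectedComponent M V.leafTopology x

theorem subset_leaf (V : CodimOneFoliation n M) {s : Set M}
    (hs : @IsPreconnected M V.leafTopology s) {x : M} (hx : x ∈ s) : s ⊆ V.leaf x :=
  @IsPreconnected.subset_connectedComponent M V.leafTopology x s hs hx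

/-! ### Foliated charts -/

theorem isFoliatedChart_of_mem_atlas (V : CodimOneFoliation n M)
    {e : OpenPartialHomeomorph M (EuclideanSpace ℝ (Fin n) × ℝ)} (he : e ∈ V.atlas) :
    V.IsFoliatedChart e where
  smooth := V.smooth e he
  smooth_symm := V.smooth_symm e he
  compatible e' he' x hx := by
    obtain ⟨U, hU, h⟩ := V.compatible e he e' he' x hx
    obtain ⟨U', hU', h'⟩ := V.compatible e' he' e he x ⟨hx.2, hx.1⟩
    refine ⟨U ∩ U', Filter.inter_mem hU hU', fun y hy z hz => ⟨h y ⟨hy.1.1, hy.2⟩ z ⟨hz.1.1, hz.2⟩,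
      h' y ⟨hy.1.2, hy.2.2, hy.2.1⟩ z ⟨hz.1.2, hz.2.2, hz.2.1⟩⟩⟩

/-- The restriction of the inverse of a foliated chart to a horizontal slice is continuous for
the leaf topology. -/
theorem IsFoliatedChart.continuousOn_slice {V : CodimOneFoliation n M}
    {e : OpenPartialHomeomorph M (EuclideanSpace ℝ (Fin n) × ℝ)} (he : V.IsFoliatedChart e)
    {B : Set (EuclideanSpace ℝ (Fin n))} {s : ℝ} (hB : ∀ p ∈ B, (p, s) ∈ e.target) :
    @ContinuousOn _ M _ V.leafTopology (fun p => e.symm (p, s)) B := by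
  refine (@continuousOn_iff_continuous_domRestrict _ M _ V.leafTopology _ _).2 ?_
  have hc : Continuous (B.domRestrict fun p => e.symm (p, s)) :=
    continuousOn_iff_continuous_domRestrict.1 (e.continuousOn_symm.comp (by fun_prop) hB)
  refine V.continuous_leafTopology hc fun e' he' x hx => ?_
  obtain ⟨U, hU, h⟩ := he.compatible e' he' _ ⟨e.map_target (hB x.1 x.2), hx⟩
  filter_upwards [hc.continuousAt hU, hc.continuousAt (e'.open_source.mem_nhds hx)] with y hy hy'
  refine (h _ ⟨hy, e.map_target (hB y.1 y.2), hy'⟩ _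
    ⟨mem_of_mem_nhds hU, e.map_target (hB x.1 x.2), hx⟩).1 ?_
  simp only [domRestrict_apply]
  rw [e.right_inv (hB y.1 y.2), e.right_inv (hB x.1 x.2)]

theorem IsFoliatedChart.isCompact_slice {V : CodimOneFoliation n M}
    {e : OpenPartialHomeomorph M (EuclideanSpace ℝ (Fin n) × ℝ)} (he : V.IsFoliatedChart e)
    {B : Set (EuclideanSpace ℝ (Fin n))} {s : ℝ} (hB : ∀ p ∈ B, (p, s) ∈ e.target)
    (hc : IsCompact B) : @IsCompact M V.leafTopology ((fun p => e.symm (p, s)) '' B) :=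
  @IsCompact.image_of_continuousOn _ M _ V.leafTopology _ _ hc (he.continuousOn_slice hB)

theorem IsFoliatedChart.leaf_symm_eq {V : CodimOneFoliation n M}
    {e : OpenPartialHomeomorph M (EuclideanSpace ℝ (Fin n) × ℝ)} (he : V.IsFoliatedChart e)
    {B : Set (EuclideanSpace ℝ (Fin n))} {s : ℝ} (hB : ∀ p ∈ B, (p, s) ∈ e.target)
    (hc : IsPreconnected B) {p q : EuclideanSpace ℝ (Fin n)} (hp : p ∈ B) (hq : q ∈ B) :
    V.leaf (e.symm (p, s)) = V.leaf (e.symm (q, s)) := by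
  have := @IsPreconnected.image _ M _ V.leafTopology _ hc _ (he.continuousOn_slice hB)
  exact V.leaf_eq (V.subset_leaf this (mem_image_of_mem _ hp) (mem_image_of_mem _ hq))

/-! ### Products of compact leaves -/

/-- An identification of an open subset of `M` with `ℝ × F` for which the sets `{t} × F` correspond
to compact leaves. -/
structure LeafProduct (V : CodimOneFoliation n M) (F : Type*) [TopologicalSpace F]
    [ChartedSpace (EuclideanSpace ℝ (Fin n)) F] where
  /-- The parametrization. -/
  map : ℝ × F → M
  /-- The first component of the inverse of the parametrization. -/
  height : M → ℝ
  /-- The second component of the inverse of the parametrization. -/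
  proj : M → F
  contMDiff_map : ContMDiff (𝓘(ℝ, ℝ).prod (𝓡 n)) (𝓡 (n + 1)) ∞ map
  isOpen_range : IsOpen (range map)
  contMDiffOn_height : ContMDiffOn (𝓡 (n + 1)) 𝓘(ℝ, ℝ) ∞ height (range map)
  contMDiffOn_proj : ContMDiffOn (𝓡 (n + 1)) (𝓡 n) ∞ proj (range map)
  height_map : ∀ t p, height (map (t, p)) = t
  proj_map : ∀ t p, proj (map (t, p)) = p
  isCompactLeaf : ∀ t, V.IsCompactLeaf (range fun p => map (t, p))

/-- Option (ii) provides a product of leaves. -/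
theorem HasProductNeighborhood.exists_leafProduct {V : CodimOneFoliation n M} {L : Set M}
    (h : V.HasProductNeighborhood L) (hne : L.Nonempty) :
    ∃ (_ : ChartedSpace (EuclideanSpace ℝ (Fin n)) L) (_ : IsManifold (𝓡 n) ∞ L)
      (Φ : V.LeafProduct L), ∀ p : L, Φ.map (0, p) = p := by
  obtain ⟨i1, i2, N, Ψ, h0, hc⟩ := h
  obtain ⟨x₀, hx₀⟩ := hne
  classical
  have hr : range (fun z => (Ψ z : M)) = N := by
    ext x
    constructor
    · rintro ⟨z, rfl⟩; exact (Ψ z).2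
    · intro hx; exact ⟨Ψ.symm ⟨x, hx⟩, by simp⟩
  refine ⟨i1, i2,
    { map := fun z => Ψ z
      -- Outside `N` both components take junk values; the one for `proj` needs a point of `L`,
      -- hence the nonemptiness hypothesis.
      height := fun x => if hx : x ∈ N then (Ψ.symm ⟨x, hx⟩).1 else 0
      proj := fun x => if hx : x ∈ N then (Ψ.symm ⟨x, hx⟩).2 else ⟨x₀, hx₀⟩
      contMDiff_map := contMDiff_subtype_val.comp Ψ.contMDiff
      isOpen_range := hr ▸ N.2
      contMDiffOn_height := ?_
      contMDiffOn_proj := ?_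
      height_map := fun t p => by simp
      proj_map := fun t p => by simp
      isCompactLeaf := hc }, h0⟩
  · rw [hr]
    intro x hx
    refine ContMDiffAt.contMDiffWithinAt ?_
    rw [← contMDiffAt_subtype_iff (U := N) (x := ⟨x, hx⟩)]
    have : ContMDiff (𝓡 (n + 1)) 𝓘(ℝ, ℝ) ∞ fun y : N => (Ψ.symm y).1 :=
      contMDiff_fst.comp Ψ.symm.contMDiff
    refine (this ⟨x, hx⟩).congr_of_eventuallyEq (Filter.Eventually.of_forall fun y => ?_)
    simp
  · rw [hr]
    intro x hx
    refine ContMDiffAt.contMDiffWithinAt ?_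
    rw [← contMDiffAt_subtype_iff (U := N) (x := ⟨x, hx⟩)]
    have : ContMDiff (𝓡 (n + 1)) (𝓡 n) ∞ fun y : N => (Ψ.symm y).2 :=
      contMDiff_snd.comp Ψ.symm.contMDiff
    refine (this ⟨x, hx⟩).congr_of_eventuallyEq (Filter.Eventually.of_forall fun y => ?_)
    simp

namespace LeafProduct

variable {V : CodimOneFoliation n M} {F : Type*} [TopologicalSpace F]
  [ChartedSpace (EuclideanSpace ℝ (Fin n)) F] (Φ : V.LeafProduct F)

theorem map_height_proj {x : M} (hx : x ∈ range Φ.map) : Φ.map (Φ.height x, Φ.proj x) = x := by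
  obtain ⟨⟨t, p⟩, rfl⟩ := hx
  rw [Φ.height_map, Φ.proj_map]

theorem continuous_map : Continuous Φ.map := Φ.contMDiff_map.continuous

theorem continuousOn_height : ContinuousOn Φ.height (range Φ.map) :=
  Φ.contMDiffOn_height.continuousOn

theorem continuousOn_proj : ContinuousOn Φ.proj (range Φ.map) := Φ.contMDiffOn_proj.continuousOn

theorem range_mem_nhds {x : M} (hx : x ∈ range Φ.map) : range Φ.map ∈ 𝓝 x :=
  Φ.isOpen_range.mem_nhds hx

theorem continuousAt_height {x : M} (hx : x ∈ range Φ.map) : ContinuousAt Φ.height x :=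
  Φ.continuousOn_height.continuousAt (Φ.range_mem_nhds hx)

theorem isOpenEmbedding_map : IsOpenEmbedding Φ.map := by
  refine .of_continuous_injective_isOpenMap Φ.continuous_map ?_ fun U hU => ?_
  · rintro ⟨t, p⟩ ⟨t', p'⟩ h
    ext1
    · simpa [Φ.height_map] using congrArg Φ.height h
    · simpa [Φ.proj_map] using congrArg Φ.proj h
  · have : Φ.map '' U = range Φ.map ∩ (fun x => (Φ.height x, Φ.proj x)) ⁻¹' U := by
      ext x
      constructor
      · rintro ⟨⟨t, p⟩, hz, rfl⟩
        refine ⟨mem_range_self _, ?_⟩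
        rwa [mem_preimage, Φ.height_map, Φ.proj_map]
      · rintro ⟨hx, hU⟩
        exact ⟨_, hU, Φ.map_height_proj hx⟩
    rw [this]
    exact (Φ.continuousOn_height.prodMk Φ.continuousOn_proj).isOpen_inter_preimage
      Φ.isOpen_range hU

theorem leaf_map (t : ℝ) (p : F) : V.leaf (Φ.map (t, p)) = range fun q => Φ.map (t, q) :=
  ((Φ.isCompactLeaf t).1.eq_leaf (mem_range_self p)).symm

theorem isCompactLeaf_leaf {x : M} (hx : x ∈ range Φ.map) : V.IsCompactLeaf (V.leaf x) := by
  obtain ⟨⟨t, p⟩, rfl⟩ := hx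
  rw [Φ.leaf_map]
  exact Φ.isCompactLeaf t

theorem leaf_subset_range {x : M} (hx : x ∈ range Φ.map) : V.leaf x ⊆ range Φ.map := by
  obtain ⟨⟨t, p⟩, rfl⟩ := hx
  rw [Φ.leaf_map]
  rintro _ ⟨q, rfl⟩
  exact mem_range_self _

theorem leaf_eq_iff {x y : M} (hx : x ∈ range Φ.map) (hy : y ∈ range Φ.map) :
    V.leaf x = V.leaf y ↔ Φ.height x = Φ.height y := by
  obtain ⟨⟨t, p⟩, rfl⟩ := hx
  obtain ⟨⟨s, q⟩, rfl⟩ := hy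
  rw [Φ.height_map, Φ.height_map]
  constructor
  · intro h
    have h1 := V.mem_leaf (Φ.map (s, q))
    rw [← h, Φ.leaf_map] at h1
    obtain ⟨p', h2⟩ := h1
    simpa [Φ.height_map] using congrArg Φ.height h2
  · rintro rfl
    rw [Φ.leaf_map, Φ.leaf_map]

/-- The fibre is compact. -/
theorem compactSpace (Φ : V.LeafProduct F) : CompactSpace F := by
  have h := V.isCompact_of_leafTopology (Φ.isCompactLeaf 0).2
  have h2 := h.image_of_continuousOn (Φ.continuousOn_proj.mono (by
    rintro _ ⟨q, rfl⟩; exact mem_range_self _))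
  refine ⟨?_⟩
  convert h2
  ext q
  simp only [mem_univ, true_iff]
  exact ⟨_, mem_range_self q, Φ.proj_map _ _⟩

/-- The fibre is connected. -/
theorem connectedSpace (Φ : V.LeafProduct F) : ConnectedSpace F := by
  obtain ⟨x, hx⟩ := (Φ.isCompactLeaf 0).1
  have h := V.isPreconnected_leaf x
  have hne : (V.leaf x).Nonempty := ⟨x, V.mem_leaf x⟩
  rw [← hx] at h hne
  have h2 := h.image _ (Φ.continuousOn_proj.mono (by
    rintro _ ⟨q, rfl⟩; exact mem_range_self _))
  have h3 : Φ.proj '' (range fun q => Φ.map (0, q)) = univ := by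
    ext q
    simp only [mem_univ, iff_true]
    exact ⟨_, mem_range_self q, Φ.proj_map _ _⟩
  rw [h3] at h2
  obtain ⟨_, q, -⟩ := hne
  exact { isPreconnected_univ := h2, toNonempty := ⟨q⟩ }

/-- Leaves close to a leaf contained in an open set are contained in this open set. -/
theorem eventually_leaf_subset {x : M} (hx : x ∈ range Φ.map) {O : Set M} (hO : IsOpen O)
    (h : V.leaf x ⊆ O) : ∀ᶠ y in 𝓝 x, V.leaf y ⊆ O := by
  have := Φ.compactSpace
  obtain ⟨⟨t, p⟩, rfl⟩ := hx
  rw [Φ.leaf_map] at h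
  obtain ⟨u, v, hu, hv, htu, hFv, huv⟩ := generalized_tube_lemma (isCompact_singleton (x := t))
    (isCompact_univ (X := F)) (hO.preimage Φ.continuous_map) (by
      rintro ⟨t', q⟩ ⟨ht', -⟩
      obtain rfl : t' = t := ht'
      exact h (mem_range_self q))
  have hx : Φ.map (t, p) ∈ range Φ.map := mem_range_self _
  filter_upwards [Φ.range_mem_nhds hx, (Φ.continuousAt_height hx).preimage_mem_nhds
    (hu.mem_nhds (by rw [Φ.height_map]; exact htu rfl))] with y hy hy'
  obtain ⟨⟨s, q⟩, rfl⟩ := hy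
  rw [Φ.leaf_map]
  rw [mem_preimage, Φ.height_map] at hy'
  rintro _ ⟨q', rfl⟩
  exact huv ⟨hy', hFv trivial⟩

/-- Leaves close to a leaf meeting an open set meet this open set. -/
theorem eventually_leaf_inter {x : M} (hx : x ∈ range Φ.map) {O : Set M} (hO : IsOpen O)
    (h : (V.leaf x ∩ O).Nonempty) : ∀ᶠ y in 𝓝 x, (V.leaf y ∩ O).Nonempty := by
  obtain ⟨⟨t, p⟩, rfl⟩ := hx
  rw [Φ.leaf_map] at h
  obtain ⟨_, ⟨q, rfl⟩, hq⟩ := h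
  have hx : Φ.map (t, p) ∈ range Φ.map := mem_range_self _
  have hc : Continuous fun s => Φ.map (s, q) := Φ.continuous_map.comp (by fun_prop)
  filter_upwards [Φ.range_mem_nhds hx, (Φ.continuousAt_height hx).preimage_mem_nhds
    ((hO.preimage hc).mem_nhds (by rw [Φ.height_map]; exact hq))] with y hy hys
  obtain ⟨⟨s, q'⟩, rfl⟩ := hy
  rw [Φ.leaf_map]
  rw [mem_preimage, Φ.height_map] at hys
  exact ⟨_, mem_range_self q, hys⟩

/-- If a leaf occurs in two products of leaves, the fibre of the second can be used in the
first. -/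
theorem exists_changeFibre {F' : Type*} [TopologicalSpace F']
    [ChartedSpace (EuclideanSpace ℝ (Fin n)) F'] (Φ : V.LeafProduct F) (Φ' : V.LeafProduct F')
    (t t' : ℝ) (h : (range fun p => Φ.map (t, p)) = range fun p => Φ'.map (t', p)) :
    ∃ Ψ : V.LeafProduct F, range Ψ.map = range Φ'.map := by
  -- On the common leaf, `p ↦ Φ'.proj (Φ.map (t, p))` and `q ↦ Φ.proj (Φ'.map (t', q))` are inverse
  -- smooth maps between `F` and `F'`. The new product is `Φ'` with its fibre transported along
  -- them.
  have hA : ∀ p, Φ'.map (t', Φ'.proj (Φ.map (t, p))) = Φ.map (t, p) := fun p => by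
    have : Φ.map (t, p) ∈ range fun p => Φ'.map (t', p) := h ▸ mem_range_self p
    obtain ⟨q, hq⟩ := this
    simp only at hq
    rw [← hq, Φ'.proj_map]
  have hB : ∀ p, Φ.map (t, Φ.proj (Φ'.map (t', p))) = Φ'.map (t', p) := fun p => by
    have : Φ'.map (t', p) ∈ range fun p => Φ.map (t, p) := h ▸ mem_range_self p
    obtain ⟨q, hq⟩ := this
    simp only at hq
    rw [← hq, Φ.proj_map]
  have hA' : ∀ p, Φ.map (t, p) ∈ range Φ'.map := fun p => hA p ▸ mem_range_self _
  have hB' : ∀ p, Φ'.map (t', p) ∈ range Φ.map := fun p => hB p ▸ mem_range_self _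
  have hslice : ∀ s, (range fun p => Φ'.map (s, Φ'.proj (Φ.map (t, p)))) =
      range fun q => Φ'.map (s, q) := fun s => by
    apply Subset.antisymm
    · rintro _ ⟨p, rfl⟩; exact mem_range_self _
    · rintro _ ⟨q, rfl⟩
      exact ⟨Φ.proj (Φ'.map (t', q)), by simp only [hB, Φ'.proj_map]⟩
  have hrange : (range fun z : ℝ × F => Φ'.map (z.1, Φ'.proj (Φ.map (t, z.2)))) =
      range Φ'.map := by
    apply Subset.antisymm
    · rintro _ ⟨p, rfl⟩; exact mem_range_self _
    · rintro _ ⟨⟨s, q⟩, rfl⟩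
      exact ⟨(s, Φ.proj (Φ'.map (t', q))), by simp only [hB, Φ'.proj_map]⟩
  refine ⟨
    { map := fun z => Φ'.map (z.1, Φ'.proj (Φ.map (t, z.2)))
      height := Φ'.height
      proj := fun x => Φ.proj (Φ'.map (t', Φ'.proj x))
      contMDiff_map := ?_
      isOpen_range := hrange ▸ Φ'.isOpen_range
      contMDiffOn_height := hrange ▸ Φ'.contMDiffOn_height
      contMDiffOn_proj := ?_
      height_map := fun s p => by simp only [Φ'.height_map]
      proj_map := fun s p => by simp only [Φ'.proj_map, hA, Φ.proj_map]
      isCompactLeaf := fun s => by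
        simp only [hslice]
        exact Φ'.isCompactLeaf s }, hrange⟩
  · refine Φ'.contMDiff_map.comp (contMDiff_fst.prodMk ?_)
    refine Φ'.contMDiffOn_proj.comp_contMDiff ?_ fun z => hA' z.2
    exact Φ.contMDiff_map.comp (contMDiff_const.prodMk contMDiff_snd)
  · rw [hrange]
    refine Φ.contMDiffOn_proj.comp ?_ fun x _ => hB' _
    exact Φ'.contMDiff_map.comp_contMDiffOn (contMDiffOn_const.prodMk Φ'.contMDiffOn_proj)

end LeafProduct

end CodimOneFoliation

/-! ### Finiteness on transversals -/

/-- A set of reals is finite if between any two non-consecutive elements of it there is an element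
of a fixed finite set. -/
theorem Set.Finite.of_separating {S Z : Set ℝ} (hZ : Z.Finite)
    (h : ∀ a ∈ S, ∀ b ∈ S, ∀ c ∈ S, a < b → b < c → ∃ z ∈ Z, a < z ∧ z < c) : S.Finite := by
  classical
  -- Send each point to the set of elements of `Z` below it. There are finitely many values, and no
  -- fibre contains three points: the separating `z` would lie below the largest but not below the
  -- smallest.
  let g : ℝ → Finset ℝ := fun s => hZ.toFinset.filter (· < s)
  have hg : ∀ s, g s ∈ hZ.toFinset.powerset := fun s => by simp [g]
  refine Set.Finite.of_finite_fibers g ((Finset.finite_toSet hZ.toFinset.powerset).subset ?_) ?_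
  · rintro _ ⟨s, -, rfl⟩
    exact hg s
  · rintro w -
    by_contra hinf
    obtain ⟨T, hT, hcard⟩ := Set.Infinite.exists_subset_card_eq hinf 3
    have key : ∀ a b c : ℝ, a ∈ T → b ∈ T → c ∈ T → a < b → b < c → False := by
      intro a b c ha hb hc hab hbc
      obtain ⟨z, hz, haz, hzc⟩ := h a (hT ha).1 b (hT hb).1 c (hT hc).1 hab hbc
      have h1 : z ∈ g c := by simp [g, hz, hzc]
      have h2 : z ∉ g a := by simp [g, haz.le]
      have ha' : g a = w := (hT ha).2
      have hc' : g c = w := (hT hc).2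
      rw [ha'] at h2
      rw [hc'] at h1
      exact h2 h1
    let f := T.orderEmbOfFin hcard
    exact key (f 0) (f 1) (f 2) (T.orderEmbOfFin_mem hcard 0) (T.orderEmbOfFin_mem hcard 1)
      (T.orderEmbOfFin_mem hcard 2) (f.strictMono (by decide)) (f.strictMono (by decide))

/-- `e` maps the closed box of radius `r` around the point `c` back to its domain. -/
def OpenPartialHomeomorph.IsBox {M E : Type*} [TopologicalSpace M] [NormedAddCommGroup E]
    (e : OpenPartialHomeomorph M (E × ℝ)) (c : E × ℝ) (r : ℝ) : Prop :=
  0 < r ∧ ∀ p ∈ Metric.closedBall c.1 r, ∀ s ∈ Metric.closedBall c.2 r, (p, s) ∈ e.target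

namespace OpenPartialHomeomorph.IsBox

variable {M E : Type*} [TopologicalSpace M] [NormedAddCommGroup E]
  {e : OpenPartialHomeomorph M (E × ℝ)} {c : E × ℝ} {r : ℝ}

theorem mem_target (hr : e.IsBox c r) {s : ℝ} (hs : s ∈ Metric.closedBall c.2 r) :
    (c.1, s) ∈ e.target :=
  hr.2 _ (Metric.mem_closedBall_self hr.1.le) s hs

theorem continuousOn_transversal (hr : e.IsBox c r) :
    ContinuousOn (fun s => e.symm (c.1, s)) (Metric.closedBall c.2 r) :=
  e.continuousOn_symm.comp (by fun_prop) fun _ hs => hr.mem_target hs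

theorem injOn_transversal (hr : e.IsBox c r) :
    InjOn (fun s => e.symm (c.1, s)) (Metric.closedBall c.2 r) := by
  intro s hs t ht h
  simpa using e.symm.injOn (hr.mem_target hs) (hr.mem_target ht) h

end OpenPartialHomeomorph.IsBox

namespace CodimOneFoliation

variable {n : ℕ} {M : Type u} [TopologicalSpace M]
  [ChartedSpace (EuclideanSpace ℝ (Fin (n + 1))) M]

section Box

variable {V : CodimOneFoliation n M}
  {e : OpenPartialHomeomorph M (EuclideanSpace ℝ (Fin n) × ℝ)}
  {c : EuclideanSpace ℝ (Fin n) × ℝ} {r : ℝ}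

theorem IsFoliatedChart.leaf_eq_of_isBox (he : V.IsFoliatedChart e) (hr : e.IsBox c r)
    {p q : EuclideanSpace ℝ (Fin n)} {s : ℝ} (hp : p ∈ Metric.closedBall c.1 r)
    (hq : q ∈ Metric.closedBall c.1 r) (hs : s ∈ Metric.closedBall c.2 r) :
    V.leaf (e.symm (p, s)) = V.leaf (e.symm (q, s)) :=
  he.leaf_symm_eq (fun p hp => hr.2 p hp s hs) (convex_closedBall _ _).isPreconnected hp hq

/-- A compact leaf meets a compact transversal in finitely many points. -/
theorem IsCompactLeaf.finite_transversal [T2Space M] {L : Set M} (hL : V.IsCompactLeaf L)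
    (he : e ∈ V.atlas) (hr : e.IsBox c r) :
    {s | s ∈ Metric.closedBall c.2 r ∧ e.symm (c.1, s) ∈ L}.Finite := by
  set T := (fun s => e.symm (c.1, s)) '' Metric.closedBall c.2 r with hT
  have hTc : IsClosed T :=
    ((isCompact_closedBall _ _).image_of_continuousOn hr.continuousOn_transversal).isClosed
  have hTc' : IsClosed[V.leafTopology] T :=
    (@isOpen_compl_iff M T V.leafTopology).1 (V.isOpen_leafTopology hTc.isOpen_compl)
  have hLT : @IsCompact M V.leafTopology (L ∩ T) :=
    @IsCompact.inter_right M V.leafTopology L T hL.2 hTc'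
  have hfin : (L ∩ T).Finite := by
    -- In the leaf topology the plaque at height `s` is open and meets `T` only at its point of
    -- parameter `s`, so the compact set `L ∩ T` is discrete.
    refine @IsCompact.finite M V.leafTopology _ hLT ?_
    rw [@isDiscrete_iff_forall_mem_exists_isOpen M V.leafTopology]
    rintro _ ⟨hsL, s, hs, rfl⟩
    refine ⟨_, V.isOpen_plaque he s, Subset.antisymm ?_ ?_⟩
    · rintro _ ⟨⟨-, h⟩, -, t, ht, rfl⟩
      simp only [e.right_inv (hr.mem_target ht)] at h
      rw [h]
      rfl
    · rintro _ rfl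
      refine ⟨⟨e.map_target (hr.mem_target hs), ?_⟩, hsL, s, hs, rfl⟩
      rw [e.right_inv (hr.mem_target hs)]
  refine Set.Finite.of_finite_image (hfin.subset ?_)
    (hr.injOn_transversal.mono fun s hs => hs.1)
  rintro _ ⟨s, ⟨hs, hsL⟩, rfl⟩
  exact ⟨hsL, s, hs, rfl⟩

/-- Points of a saturated set accumulating at one point of a plaque accumulate at each point of
the plaque, along the transversal. -/
theorem IsFoliatedChart.frequently_mem_of_isBox (he : V.IsFoliatedChart e) (hr : e.IsBox c r)
    {G : Set M} (hG : ∀ x ∈ G, V.leaf x ⊆ G) {p q : EuclideanSpace ℝ (Fin n)} {s : ℝ}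
    (hp : p ∈ Metric.ball c.1 r) (hq : q ∈ Metric.ball c.1 r) (hs : s ∈ Metric.ball c.2 r)
    (h : e.symm (p, s) ∈ closure G) :
    ∃ᶠ s' in 𝓝 s, e.symm (q, s') ∈ G := by
  have hps : (p, s) ∈ e.target :=
    hr.2 p (Metric.ball_subset_closedBall hp) s (Metric.ball_subset_closedBall hs)
  have hsrc := e.map_target hps
  have hc : Filter.Tendsto (fun z => (e z).2) (𝓝 (e.symm (p, s))) (𝓝 s) := by
    have := (continuous_snd.tendsto _).comp (e.continuousAt hsrc)
    rwa [e.right_inv hps] at this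
  have hev : ∀ᶠ z in 𝓝 (e.symm (p, s)), z ∈ e.source ∩
      e ⁻¹' (Metric.ball c.1 r ×ˢ Metric.ball c.2 r) :=
    (e.isOpen_inter_preimage (Metric.isOpen_ball.prod Metric.isOpen_ball)).mem_nhds
      ⟨hsrc, by rw [mem_preimage, e.right_inv hps]; exact ⟨hp, hs⟩⟩
  -- Slide the nearby points of `G` along their plaques to the transversal over `q`: they stay in
  -- `G`, and their heights, unchanged, tend to `s`.
  refine hc.frequently (((mem_closure_iff_frequently.1 h).and_eventually hev).mono ?_)
  rintro z ⟨hz, hzs, hz1, hz2⟩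
  have := he.leaf_eq_of_isBox hr (Metric.ball_subset_closedBall hz1)
    (Metric.ball_subset_closedBall hq) (Metric.ball_subset_closedBall hz2)
  rw [Prod.mk.eta, e.left_inv hzs] at this
  exact hG z hz (this ▸ V.mem_leaf _)

/-- A connected component of the intersection of a transversal with a connected open set of leaves
having product neighbourhoods meets all these leaves. -/
theorem IsFoliatedChart.leaf_inter_gap [T2Space M] {F : Type*} [TopologicalSpace F]
    [ChartedSpace (EuclideanSpace ℝ (Fin n)) F] (he : V.IsFoliatedChart e) (hr : e.IsBox c r)
    {G : Set M} (hGo : IsOpen G) (hGc : IsPreconnected G) (hG : ∀ x ∈ G, V.leaf x ⊆ G)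
    (hGF : ∀ x ∈ G, ∃ Φ : V.LeafProduct F, x ∈ range Φ.map) {a b o : ℝ}
    (ha : a ∈ Metric.closedBall c.2 r) (hb : b ∈ Metric.closedBall c.2 r) (ho : o ∈ Ioo a b)
    (haG : e.symm (c.1, a) ∉ G) (hbG : e.symm (c.1, b) ∉ G)
    (hJ : ∀ s ∈ Ioo a b, e.symm (c.1, s) ∈ G) {x : M} (hx : x ∈ G) :
    ∃ s ∈ Ioo a b, e.symm (c.1, s) ∈ V.leaf x := by
  have hab : Icc a b ⊆ Metric.closedBall c.2 r := by
    rw [Real.closedBall_eq_Icc] at *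
    exact Icc_subset_Icc ha.1 hb.2
  set K := (fun s => e.symm (c.1, s)) '' Icc a b with hK
  have hKc : IsClosed K :=
    (isCompact_Icc.image_of_continuousOn (hr.continuousOn_transversal.mono hab)).isClosed
  set O := e.source ∩ e ⁻¹' (Metric.ball c.1 r ×ˢ Ioo a b) with hO
  have hOo : IsOpen O := e.isOpen_inter_preimage (Metric.isOpen_ball.prod isOpen_Ioo)
  have hmemO : ∀ s ∈ Ioo a b, e.symm (c.1, s) ∈ O := fun s hs => by
    have := hr.mem_target (hab (Ioo_subset_Icc_self hs))
    refine ⟨e.map_target this, ?_⟩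
    rw [mem_preimage, e.right_inv this]
    exact ⟨Metric.mem_ball_self hr.1, hs⟩
  -- Leaves meeting the open box `O` and leaves missing the compact transversal `K` form two open
  -- sets covering `G`. They are disjoint, since a plaque in the box reaches `K`. A leaf of `G` that
  -- meets `K` does so strictly between `a` and `b`, as the endpoints are not in `G`.
  set U₁ := {y | y ∈ G ∧ (V.leaf y ∩ O).Nonempty} with hU₁
  set U₂ := {y | y ∈ G ∧ V.leaf y ⊆ Kᶜ} with hU₂
  have h₁ : IsOpen U₁ := by
    rw [isOpen_iff_mem_nhds]
    rintro y ⟨hyG, hy⟩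
    obtain ⟨Φ, hΦ⟩ := hGF y hyG
    exact Filter.inter_mem (hGo.mem_nhds hyG) (Φ.eventually_leaf_inter hΦ hOo hy)
  have h₂ : IsOpen U₂ := by
    rw [isOpen_iff_mem_nhds]
    rintro y ⟨hyG, hy⟩
    obtain ⟨Φ, hΦ⟩ := hGF y hyG
    exact Filter.inter_mem (hGo.mem_nhds hyG) (Φ.eventually_leaf_subset hΦ hKc.isOpen_compl hy)
  have hcross : ∀ y ∈ G, ¬ V.leaf y ⊆ Kᶜ → ∃ s ∈ Ioo a b, e.symm (c.1, s) ∈ V.leaf y := by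
    intro y hy h
    obtain ⟨z, hz, hzK⟩ := not_subset.1 h
    rw [notMem_compl_iff] at hzK
    obtain ⟨s, hs, rfl⟩ := hzK
    have hsG := hG y hy hz
    have hsa : s ≠ a := by rintro rfl; exact haG hsG
    have hsb : s ≠ b := by rintro rfl; exact hbG hsG
    exact ⟨s, ⟨lt_of_le_of_ne hs.1 hsa.symm, lt_of_le_of_ne hs.2 hsb⟩, hz⟩
  refine hcross x hx fun hxK => ?_
  have hcov : G ⊆ U₁ ∪ U₂ := by
    intro y hy
    by_cases h : V.leaf y ⊆ Kᶜ
    · exact Or.inr ⟨hy, h⟩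
    · obtain ⟨s, hs, hsy⟩ := hcross y hy h
      exact Or.inl ⟨hy, _, hsy, hmemO s hs⟩
  obtain ⟨y, -, ⟨-, z, hzy, hzs, hzp, hzJ⟩, -, hyK⟩ := hGc U₁ U₂ h₁ h₂ hcov
    ⟨_, hJ o ho, hJ o ho, _, V.mem_leaf _, hmemO o ho⟩ ⟨x, hx, hx, hxK⟩
  have hleaf := he.leaf_eq_of_isBox hr (Metric.ball_subset_closedBall hzp)
    (Metric.mem_closedBall_self hr.1.le) (hab (Ioo_subset_Icc_self hzJ))
  rw [Prod.mk.eta, e.left_inv hzs, ← V.leaf_eq hzy] at hleaf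
  refine @hyK (e.symm (c.1, (e z).2)) ?_ ⟨_, Ioo_subset_Icc_self hzJ, rfl⟩
  rw [hleaf]
  exact V.mem_leaf _

/-- The frontier of a connected open set of leaves with product neighbourhoods meets transversals
in finitely many points. -/
theorem IsFoliatedChart.finite_frontier [T2Space M] {F : Type*} [TopologicalSpace F]
    [ChartedSpace (EuclideanSpace ℝ (Fin n)) F] (he : e ∈ V.atlas) (hr : e.IsBox c r)
    {G : Set M} (hGo : IsOpen G) (hGc : IsPreconnected G) (hG : ∀ x ∈ G, V.leaf x ⊆ G)
    (hGF : ∀ x ∈ G, ∃ Φ : V.LeafProduct F, x ∈ range Φ.map) :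
    {s | s ∈ Metric.ball c.2 r ∧ e.symm (c.1, s) ∈ closure G \ G}.Finite := by
  have he' := V.isFoliatedChart_of_mem_atlas he
  rcases G.eq_empty_or_nonempty with rfl | ⟨x₀, hx₀⟩
  · simp
  obtain ⟨Φ₀, hΦ₀⟩ := hGF x₀ hx₀
  refine Set.Finite.of_separating ((Φ₀.isCompactLeaf_leaf hΦ₀).finite_transversal he hr) ?_
  rintro s₁ ⟨hs₁, hs₁G⟩ s₂ ⟨hs₂, hs₂G⟩ s₃ ⟨hs₃, hs₃G⟩ h12 h23
  have hp := Metric.mem_ball_self (x := c.1) hr.1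
  -- A frontier point is a limit of `G` along the transversal, so `G` has a point `o` between `s₁`
  -- and `s₃`.
  obtain ⟨o, hoG, ho⟩ := ((he'.frequently_mem_of_isBox hr hG hp hp hs₂ hs₂G.1).and_eventually
    (Ioo_mem_nhds h12 h23)).exists
  have hsub : Icc s₁ s₃ ⊆ Metric.closedBall c.2 r := by
    have h1 := Metric.ball_subset_closedBall hs₁
    have h3 := Metric.ball_subset_closedBall hs₃
    rw [Real.closedBall_eq_Icc] at *
    exact Icc_subset_Icc h1.1 h3.2
  have hC : IsCompact {s | s ∈ Icc s₁ s₃ ∧ e.symm (c.1, s) ∈ Gᶜ} :=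
    isCompact_Icc.of_isClosed_subset ((hr.continuousOn_transversal.mono
      hsub).preimage_isClosed_of_isClosed isClosed_Icc hGo.isClosed_compl) fun _ h => h.1
  -- `a` and `b` are the ends of the gap of `G` around `o`; this gap meets the fixed compact leaf
  -- through `x₀`.
  obtain ⟨a, ⟨⟨haI, haG⟩, hao⟩, ha⟩ := (hC.inter_right (isClosed_Iic (a := o))).exists_isGreatest
    ⟨s₁, ⟨⟨le_rfl, (h12.trans h23).le⟩, hs₁G.2⟩, ho.1.le⟩
  obtain ⟨b, ⟨⟨hbI, hbG⟩, hbo⟩, hb⟩ := (hC.inter_right (isClosed_Ici (a := o))).exists_isLeast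
    ⟨s₃, ⟨⟨(h12.trans h23).le, le_rfl⟩, hs₃G.2⟩, ho.2.le⟩
  have hao' : a < o := lt_of_le_of_ne hao (by rintro rfl; exact haG hoG)
  have hbo' : o < b := lt_of_le_of_ne hbo (by rintro rfl; exact hbG hoG)
  obtain ⟨s, hs, hsL⟩ := he'.leaf_inter_gap hr hGo hGc hG hGF (hsub haI) (hsub hbI) ⟨hao', hbo'⟩
    haG hbG (fun s hs => by
      by_contra hsG
      have hsI : s ∈ Icc s₁ s₃ := ⟨haI.1.trans hs.1.le, hs.2.le.trans hbI.2⟩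
      rcases le_total s o with h | h
      · exact absurd (ha ⟨⟨hsI, hsG⟩, h⟩) (not_le.2 hs.1)
      · exact absurd (hb ⟨⟨hsI, hsG⟩, h⟩) (not_le.2 hs.2)) hx₀
  exact ⟨s, ⟨hsub ⟨haI.1.trans hs.1.le, hs.2.le.trans hbI.2⟩, hsL⟩, haI.1.trans_lt hs.1,
    hs.2.trans_le hbI.2⟩

end Box

/-! ### Compactness of frontier leaves, and products covering `M` -/

/-- The leaves in the frontier of a connected open set of leaves with product neighbourhoods are
compact. -/
theorem isCompactLeaf_of_mem_frontier [T2Space M] [CompactSpace M] {V : CodimOneFoliation n M}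
    {F : Type*} [TopologicalSpace F]
    [ChartedSpace (EuclideanSpace ℝ (Fin n)) F]
    {G : Set M} (hGo : IsOpen G) (hGc : IsPreconnected G) (hG : ∀ x ∈ G, V.leaf x ⊆ G)
    (hGF : ∀ x ∈ G, ∃ Φ : V.LeafProduct F, x ∈ range Φ.map) {y : M} (hy : y ∈ closure G \ G) :
    V.IsCompactLeaf (V.leaf y) := by
  have hBc : IsClosed (closure G \ G) := isClosed_closure.sdiff hGo
  have hBc' : IsClosed[V.leafTopology] (closure G \ G) :=
    (@isOpen_compl_iff M _ V.leafTopology).1 (V.isOpen_leafTopology hBc.isOpen_compl)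
  choose e he hes using V.covers
  have hbox : ∀ x, ∃ r, (e x).IsBox (e x x) r := fun x => by
    obtain ⟨r, hr, h⟩ := OpenPartialHomeomorph.exists_box (hes x) (O := univ) Filter.univ_mem
    exact ⟨r, hr, fun p hp s hs => (h p hp s hs).1⟩
  choose r hr using hbox
  have hplaque : ∀ x, ∀ p ∈ Metric.ball (e x x).1 (r x), ∀ q ∈ Metric.ball (e x x).1 (r x),
      ∀ s ∈ Metric.ball (e x x).2 (r x), (e x).symm (p, s) ∈ closure G \ G →
      (e x).symm (q, s) ∈ closure G \ G := by
    intro x p hp q hq s hs h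
    have hfc := V.isFoliatedChart_of_mem_atlas (he x)
    have hqt := (hr x).2 q (Metric.ball_subset_closedBall hq) s (Metric.ball_subset_closedBall hs)
    refine ⟨?_, fun hqG => h.2 (hG _ hqG ?_)⟩
    · have hT : Filter.Tendsto (fun s' => (e x).symm (q, s')) (𝓝 s) (𝓝 ((e x).symm (q, s))) :=
        ((e x).continuousAt_symm hqt).tendsto.comp
          ((Continuous.prodMk_right q).tendsto s)
      exact mem_closure_iff_frequently.2
        (hT.frequently (hfc.frequently_mem_of_isBox (hr x) hG hp hq hs h.1))
    · rw [hfc.leaf_eq_of_isBox (hr x) (Metric.ball_subset_closedBall hq)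
        (Metric.ball_subset_closedBall hp) (Metric.ball_subset_closedBall hs)]
      exact V.mem_leaf _
  -- The frontier contains the whole plaque of each of its points, so it is clopen in the leaf
  -- topology and contains the leaf of `y`.
  have hBo : IsOpen[V.leafTopology] (closure G \ G) := by
    refine (@isOpen_iff_forall_mem_open M V.leafTopology _).2 fun x hx => ?_
    refine ⟨{z | z ∈ (e x).source ∧ (e x z).2 = (e x x).2} ∩ ((e x).source ∩ e x ⁻¹'
      (Metric.ball (e x x).1 (r x) ×ˢ univ)), ?_, ?_, ⟨hes x, rfl⟩, hes x,
        Metric.mem_ball_self (hr x).1, trivial⟩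
    · rintro z ⟨⟨hz, hz2⟩, -, hz1, -⟩
      have := hplaque x (e x x).1 (Metric.mem_ball_self (hr x).1) (e x z).1 hz1 (e x x).2
        (Metric.mem_ball_self (hr x).1) (by rwa [Prod.mk.eta, (e x).left_inv (hes x)])
      rwa [← hz2, Prod.mk.eta, (e x).left_inv hz] at this
    · exact @IsOpen.inter M V.leafTopology _ _ (V.isOpen_plaque (he x) _)
        (V.isOpen_leafTopology ((e x).isOpen_inter_preimage (Metric.isOpen_ball.prod isOpen_univ)))
  have hsub : V.leaf y ⊆ closure G \ G :=
    V.leaf_subset_of_isClopen (⟨hBc', hBo⟩) hy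
  refine ⟨⟨y, rfl⟩, ?_⟩
  obtain ⟨T, -, hT⟩ := (isCompact_univ (X := M)).elim_nhds_subcover
    (fun x => (e x).source ∩ e x ⁻¹'
      (Metric.ball (e x x).1 (r x / 2) ×ˢ Metric.ball (e x x).2 (r x / 2)))
    fun x _ => ((e x).isOpen_inter_preimage (Metric.isOpen_ball.prod Metric.isOpen_ball)).mem_nhds
      ⟨hes x, Metric.mem_ball_self (half_pos (hr x).1), Metric.mem_ball_self (half_pos (hr x).1)⟩
  set S : M → Set ℝ := fun x =>
    {s | s ∈ Metric.ball (e x x).2 (r x) ∧ (e x).symm ((e x x).1, s) ∈ closure G \ G} with hS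
  have hSfin : ∀ x, (S x).Finite := fun x =>
    IsFoliatedChart.finite_frontier (he x) (hr x) hGo hGc hG hGF
  -- Finitely many boxes, each with finitely many frontier heights, cover the frontier by finitely
  -- many compact plaques. Halving the radii keeps these closed plaques inside the boxes.
  have hcpt : @IsCompact M V.leafTopology (⋃ x ∈ T, ⋃ s ∈ S x,
      (fun p => (e x).symm (p, s)) '' Metric.closedBall (e x x).1 (r x / 2)) := by
    refine @Finset.isCompact_biUnion M _ V.leafTopology T _ fun x _ => ?_
    refine @Set.Finite.isCompact_biUnion M _ V.leafTopology _ _ (hSfin x) fun s hs => ?_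
    exact (V.isFoliatedChart_of_mem_atlas (he x)).isCompact_slice (fun p hp => (hr x).2 p
      (Metric.closedBall_subset_closedBall (half_le_self (hr x).1.le) hp) s
      (Metric.ball_subset_closedBall hs.1)) (isCompact_closedBall _ _)
  refine @IsCompact.of_isClosed_subset M V.leafTopology _ _ hcpt (V.isClosed_leaf y) ?_
  intro z hz
  have hzB := hsub hz
  obtain ⟨x, hx, hzs, hz1, hz2⟩ := mem_iUnion₂.1 (hT (mem_univ z))
  have hlt := half_le_self (hr x).1.le
  have hz2' := Metric.ball_subset_ball hlt hz2
  refine mem_iUnion₂.2 ⟨x, hx, mem_iUnion₂.2 ⟨(e x z).2, ⟨hz2', ?_⟩, (e x z).1,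
    Metric.ball_subset_closedBall hz1, (e x).left_inv hzs⟩⟩
  exact hplaque x (e x z).1 (Metric.ball_subset_ball hlt hz1) _ (Metric.mem_ball_self (hr x).1) _
    hz2' (by rwa [Prod.mk.eta, (e x).left_inv hzs])

/-- Under the dichotomy property, if one product of leaves exists then such products cover `M`. -/
theorem DichotomyProperty.exists_leafProduct [T2Space M] [CompactSpace M] [ConnectedSpace M]
    {V : CodimOneFoliation n M} (hV : V.DichotomyProperty) {F : Type*} [TopologicalSpace F]
    [ChartedSpace (EuclideanSpace ℝ (Fin n)) F] (Φ₀ : V.LeafProduct F) (x : M) :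
    ∃ Φ : V.LeafProduct F, x ∈ range Φ.map := by
  have hFc := Φ₀.connectedSpace
  have : LocallyConnectedSpace M :=
    ChartedSpace.locallyConnectedSpace (EuclideanSpace ℝ (Fin (n + 1))) M
  set P : Set M := ⋃ Φ : V.LeafProduct F, range Φ.map with hP
  have hPo : IsOpen P := isOpen_iUnion fun Φ => Φ.isOpen_range
  obtain ⟨p₀⟩ := hFc.toNonempty
  set x₀ := Φ₀.map (0, p₀) with hx₀
  have hx₀P : x₀ ∈ P := mem_iUnion.2 ⟨Φ₀, mem_range_self _⟩
  have hPsat : ∀ x ∈ P, V.leaf x ⊆ P := fun x hx => by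
    obtain ⟨Φ, hΦ⟩ := mem_iUnion.1 hx
    exact (Φ.leaf_subset_range hΦ).trans (subset_iUnion (fun Φ : V.LeafProduct F => range Φ.map) Φ)
  set G := connectedComponentIn P x₀ with hGdef
  have hGP : G ⊆ P := connectedComponentIn_subset _ _
  have hGo : IsOpen G := hPo.connectedComponentIn
  have hGc : IsPreconnected G := isPreconnected_connectedComponentIn
  have hG : ∀ x ∈ G, V.leaf x ⊆ G := fun x hx => by
    rw [hGdef, connectedComponentIn_eq hx]
    exact (V.isPreconnected_leaf x).subset_connectedComponentIn (V.mem_leaf x) (hPsat x (hGP hx))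
  have hclP : closure G ⊆ P := by
    intro y hy
    by_contra hyP
    have hyG : y ∉ G := fun h => hyP (hGP h)
    have hcy : V.IsCompactLeaf (V.leaf y) := isCompactLeaf_of_mem_frontier hGo hGc hG
      (fun x hx => mem_iUnion.1 (hGP hx)) ⟨hy, hyG⟩
    have hdisj : ∀ z ∈ P, z ∉ V.leaf y := fun z hz hzy =>
      hyP (hPsat z hz (V.leaf_eq hzy ▸ V.mem_leaf y))
    -- The compact leaves of `G` near `y` exclude option (i). Under (ii), the product around the
    -- leaf of `y` shares a leaf with a product of fibre `F`, so `exists_changeFibre` puts `y` in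
    -- `P`.
    obtain ⟨U, hU, h | h⟩ := hV _ hcy
    · obtain ⟨z, hzU, hzG⟩ := mem_closure_iff_nhds.1 hy U
        (nhds_le_nhdsSet (V.mem_leaf y) hU)
      obtain ⟨Φ, hΦ⟩ := mem_iUnion.1 (hGP hzG)
      exact h (V.leaf z) ⟨z, rfl⟩ ⟨z, V.mem_leaf z, hzU, hdisj z (hGP hzG)⟩
        (Φ.isCompactLeaf_leaf hΦ)
    · obtain ⟨_, _, Φ', hΦ'⟩ := h.2.exists_leafProduct ⟨y, V.mem_leaf y⟩
      have hyΦ' : y ∈ range Φ'.map := ⟨(0, ⟨y, V.mem_leaf y⟩), hΦ' _⟩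
      obtain ⟨z, ⟨⟨t', q⟩, hz⟩, hzG⟩ := mem_closure_iff_nhds.1 hy _ (Φ'.range_mem_nhds hyΦ')
      obtain ⟨Φ, ⟨t, p⟩, hΦ⟩ := mem_iUnion.1 (hGP hzG)
      obtain ⟨Ψ, hΨ⟩ := Φ.exists_changeFibre Φ' t t' (by
        rw [← Φ.leaf_map t p, ← Φ'.leaf_map t' q, hz, hΦ])
      exact hyP (mem_iUnion.2 ⟨Ψ, hΨ ▸ hyΦ'⟩)
  have hGcl : IsClosed G := by
    refine isClosed_of_closure_subset ?_
    have := hGc.closure.subset_connectedComponentIn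
      (subset_closure (mem_connectedComponentIn hx₀P)) hclP
    exact this
  have : G = univ := IsClopen.eq_univ ⟨hGcl, hGo⟩ ⟨x₀, mem_connectedComponentIn hx₀P⟩
  exact mem_iUnion.1 (hGP (this ▸ mem_univ x))

/-! ### Transverse orientation of products -/

/-- The transverse coordinate of a foliated chart is locally a differentiable function of the
transverse coordinate of another one. -/
theorem IsFoliatedChart.eventually_eq_comp {V : CodimOneFoliation n M}
    {e e' : OpenPartialHomeomorph M (EuclideanSpace ℝ (Fin n) × ℝ)} (he : V.IsFoliatedChart e)
    (he' : V.IsFoliatedChart e') {x : M} (hx : x ∈ e.source) (hx' : x ∈ e'.source) :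
    ∀ᶠ y in 𝓝 x, (e' y).2 = (e' (e.symm ((e x).1, (e y).2))).2 := by
  -- Compatibility is only given against `V.atlas`, so `e` and `e'` are compared through a chart
  -- `e₀` of the atlas.
  obtain ⟨e₀, he₀, hx₀⟩ := V.covers x
  obtain ⟨U, hU, h⟩ := he.compatible e₀ he₀ x ⟨hx, hx₀⟩
  obtain ⟨U', hU', h'⟩ := he'.compatible e₀ he₀ x ⟨hx', hx₀⟩
  obtain ⟨r, hr, hbox⟩ := e.exists_box hx (Filter.inter_mem (Filter.inter_mem hU hU')
    (Filter.inter_mem (e'.open_source.mem_nhds hx') (e₀.open_source.mem_nhds hx₀)))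
  filter_upwards [(e.isOpen_inter_preimage (Metric.isOpen_ball.prod Metric.isOpen_ball)).mem_nhds
    (⟨hx, Metric.mem_ball_self hr, Metric.mem_ball_self hr⟩ :
      x ∈ e.source ∩ e ⁻¹' (Metric.ball (e x).1 r ×ˢ Metric.ball (e x).2 r))]
  rintro y ⟨hys, hy1, hy2⟩
  have hy2' := Metric.ball_subset_closedBall hy2
  have hb1 := (hbox _ (Metric.ball_subset_closedBall hy1) _ hy2').2
  rw [Prod.mk.eta, e.left_inv hys] at hb1
  obtain ⟨hzt, hb2⟩ := hbox _ (Metric.mem_closedBall_self hr.le) _ hy2'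
  have hzs := e.map_target hzt
  refine (h' y ⟨hb1.1.2, hb1.2⟩ _ ⟨hb2.1.2, hb2.2⟩).2
    ((h y ⟨hb1.1.1, hys, hb1.2.2⟩ _ ⟨hb2.1.1, hzs, hb2.2.2⟩).1 ?_)
  rw [e.right_inv hzt]

theorem IsFoliatedChart.contMDiffOn_comp_transversal {V : CodimOneFoliation n M}
    {e : OpenPartialHomeomorph M (EuclideanSpace ℝ (Fin n) × ℝ)} (he : V.IsFoliatedChart e)
    {g : M → ℝ} {U : Set M} (hg : ContMDiffOn (𝓡 (n + 1)) 𝓘(ℝ, ℝ) ∞ g U)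
    {p : EuclideanSpace ℝ (Fin n)} {J : Set ℝ}
    (hJ : ∀ s ∈ J, (p, s) ∈ e.target ∧ e.symm (p, s) ∈ U) :
    ContDiffOn ℝ ∞ (fun s => g (e.symm (p, s))) J := by
  rw [← contMDiffOn_iff_contDiffOn]
  have h1 : ContMDiff 𝓘(ℝ, ℝ) 𝓘(ℝ, EuclideanSpace ℝ (Fin n) × ℝ) ∞ fun s : ℝ => (p, s) := by
    rw [contMDiff_iff_contDiff]
    fun_prop
  exact hg.comp (he.smooth_symm.comp h1.contMDiffOn fun s hs => (hJ s hs).1)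
    fun s hs => (hJ s hs).2

theorem IsFoliatedChart.contMDiffOn_snd {V : CodimOneFoliation n M}
    {e : OpenPartialHomeomorph M (EuclideanSpace ℝ (Fin n) × ℝ)} (he : V.IsFoliatedChart e) :
    ContMDiffOn (𝓡 (n + 1)) 𝓘(ℝ, ℝ) ∞ (fun x => (e x).2) e.source := by
  have h1 : ContMDiff 𝓘(ℝ, EuclideanSpace ℝ (Fin n) × ℝ) 𝓘(ℝ, ℝ) ∞
      (Prod.snd : EuclideanSpace ℝ (Fin n) × ℝ → ℝ) := by
    rw [contMDiff_iff_contDiff]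
    fun_prop
  exact h1.comp_contMDiffOn he.smooth

namespace LeafProduct

variable {V : CodimOneFoliation n M} {F : Type*} [TopologicalSpace F]
  [ChartedSpace (EuclideanSpace ℝ (Fin n)) F] (Φ : V.LeafProduct F)

theorem contDiffAt_curve {g : M → ℝ} {t : ℝ} {p : F}
    (hg : ContMDiffAt (𝓡 (n + 1)) 𝓘(ℝ, ℝ) ∞ g (Φ.map (t, p))) :
    ContDiffAt ℝ ∞ (fun s => g (Φ.map (s, p))) t := by
  rw [← contMDiffAt_iff_contDiffAt]
  have h1 : ContMDiff 𝓘(ℝ, ℝ) (𝓘(ℝ, ℝ).prod (𝓡 n)) ∞ fun s : ℝ => (s, p) :=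
    contMDiff_id.prodMk contMDiff_const
  exact hg.comp t (Φ.contMDiff_map.comp h1).contMDiffAt

theorem continuous_curve (p : F) : Continuous fun s => Φ.map (s, p) :=
  Φ.continuous_map.comp (Continuous.prodMk_left p)

theorem differentiableAt_snd {e : OpenPartialHomeomorph M (EuclideanSpace ℝ (Fin n) × ℝ)}
    (he : V.IsFoliatedChart e) {t : ℝ} {p : F} (hx : Φ.map (t, p) ∈ e.source) :
    DifferentiableAt ℝ (fun s => (e (Φ.map (s, p))).2) t :=
  (Φ.contDiffAt_curve (he.contMDiffOn_snd.contMDiffAt (e.open_source.mem_nhds hx))).differentiableAt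
    (by simp)

/-- The height is locally a smooth function of the transverse coordinate of a foliated chart. -/
theorem exists_height_eq_comp {e : OpenPartialHomeomorph M (EuclideanSpace ℝ (Fin n) × ℝ)}
    (he : V.IsFoliatedChart e) {x : M} (hx : x ∈ e.source) (hxΦ : x ∈ range Φ.map) :
    ∃ (O : Set M) (J : Set ℝ) (H : ℝ → ℝ), IsOpen O ∧ x ∈ O ∧ O ⊆ e.source ∧ IsOpen J ∧
      ContDiffOn ℝ ∞ H J ∧ ∀ y ∈ O, (e y).2 ∈ J ∧ Φ.height y = H (e y).2 := by
  obtain ⟨r, hr, hbox⟩ := e.exists_box hx (Φ.range_mem_nhds hxΦ)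
  have hr' : e.IsBox (e x) r := ⟨hr, fun p hp s hs => (hbox p hp s hs).1⟩
  have hc := Metric.mem_closedBall_self (x := (e x).1) hr.le
  refine ⟨e.source ∩ e ⁻¹' (Metric.ball (e x).1 r ×ˢ Metric.ball (e x).2 r), Metric.ball (e x).2 r,
    fun s => Φ.height (e.symm ((e x).1, s)),
    e.isOpen_inter_preimage (Metric.isOpen_ball.prod Metric.isOpen_ball),
    ⟨hx, Metric.mem_ball_self hr, Metric.mem_ball_self hr⟩, inter_subset_left, Metric.isOpen_ball,
    he.contMDiffOn_comp_transversal Φ.contMDiffOn_height fun s hs =>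
      hbox _ hc s (Metric.ball_subset_closedBall hs), ?_⟩
  rintro y ⟨hys, hy1, hy2⟩
  refine ⟨hy2, ?_⟩
  have hy1' := Metric.ball_subset_closedBall hy1
  have hy2' := Metric.ball_subset_closedBall hy2
  have hyr := (hbox _ hy1' _ hy2').2
  have := he.leaf_eq_of_isBox hr' hy1' hc hy2'
  rw [Prod.mk.eta, e.left_inv hys] at this hyr
  exact (Φ.leaf_eq_iff hyr (hbox _ hc _ hy2').2).1 this

/-- Along the curve `s ↦ Φ.map (s, p)` the height is `s`, so `H` inverts the transverse coordinate
there and the chain rule applies. Thus both derivatives are nonzero and of equal sign, which lets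
signs be read off the one-variable function `H`. -/
theorem deriv_mul_deriv_eq_one {e : OpenPartialHomeomorph M (EuclideanSpace ℝ (Fin n) × ℝ)}
    (he : V.IsFoliatedChart e) {O : Set M} {J : Set ℝ} {H : ℝ → ℝ} (hO : IsOpen O)
    (hOe : O ⊆ e.source) (hJ : IsOpen J) (hH : ContDiffOn ℝ ∞ H J)
    (h : ∀ y ∈ O, (e y).2 ∈ J ∧ Φ.height y = H (e y).2) {t : ℝ} {p : F}
    (ht : Φ.map (t, p) ∈ O) :
    deriv H (e (Φ.map (t, p))).2 * deriv (fun s => (e (Φ.map (s, p))).2) t = 1 := by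
  have hd := Φ.differentiableAt_snd he (hOe ht)
  have hHd : DifferentiableAt ℝ H (e (Φ.map (t, p))).2 :=
    (hH.contDiffAt (hJ.mem_nhds (h _ ht).1)).differentiableAt (by simp)
  rw [← deriv_comp (h₂ := H) (h := fun s => (e (Φ.map (s, p))).2) t hHd hd]
  have : (H ∘ fun s => (e (Φ.map (s, p))).2) =ᶠ[𝓝 t] id := by
    filter_upwards [(Φ.continuous_curve p).continuousAt.preimage_mem_nhds (hO.mem_nhds ht)]
      with s hs
    rw [Function.comp_apply, ← (h _ hs).2, Φ.height_map, id]
  rw [this.deriv_eq, deriv_id]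

/-- The product is positively oriented with respect to the foliated charts in `A`. -/
def IsOriented (A : Set (OpenPartialHomeomorph M (EuclideanSpace ℝ (Fin n) × ℝ))) : Prop :=
  ∀ e ∈ A, ∀ t p, Φ.map (t, p) ∈ e.source → 0 < deriv (fun s => (e (Φ.map (s, p))).2) t

/-- An affine change of the `ℝ` coordinate. -/
noncomputable def reparam (a b : ℝ) (ha : a ≠ 0) : V.LeafProduct F where
  map z := Φ.map (a * z.1 + b, z.2)
  height x := (Φ.height x - b) / a
  proj := Φ.proj
  contMDiff_map := by
    have h1 : ContMDiff 𝓘(ℝ, ℝ) 𝓘(ℝ, ℝ) ∞ fun s : ℝ => a * s + b := by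
      rw [contMDiff_iff_contDiff]
      fun_prop
    exact Φ.contMDiff_map.comp ((h1.comp contMDiff_fst).prodMk contMDiff_snd)
  isOpen_range := by
    convert Φ.isOpen_range using 1
    refine Subset.antisymm (by rintro _ ⟨z, rfl⟩; exact mem_range_self _) ?_
    rintro _ ⟨⟨t, p⟩, rfl⟩
    exact ⟨((t - b) / a, p), by simp only [mul_div_cancel₀ _ ha, sub_add_cancel]⟩
  contMDiffOn_height := by
    have h1 : ContMDiff 𝓘(ℝ, ℝ) 𝓘(ℝ, ℝ) ∞ fun s : ℝ => (s - b) / a := by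
      rw [contMDiff_iff_contDiff]
      fun_prop
    exact h1.comp_contMDiffOn (Φ.contMDiffOn_height.mono (by
      rintro _ ⟨z, rfl⟩; exact mem_range_self _))
  contMDiffOn_proj := Φ.contMDiffOn_proj.mono (by rintro _ ⟨z, rfl⟩; exact mem_range_self _)
  height_map t p := by simp only [Φ.height_map]; field_simp; ring
  proj_map t p := by simp only [Φ.proj_map]
  isCompactLeaf t := Φ.isCompactLeaf (a * t + b)

variable {A : Set (OpenPartialHomeomorph M (EuclideanSpace ℝ (Fin n) × ℝ))}

theorem deriv_reparam (a b : ℝ) (ha : a ≠ 0)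
    (e : OpenPartialHomeomorph M (EuclideanSpace ℝ (Fin n) × ℝ)) (t : ℝ) (p : F) :
    deriv (fun s => (e ((Φ.reparam a b ha).map (s, p))).2) t =
      a * deriv (fun s => (e (Φ.map (s, p))).2) (a * t + b) := by
  have h1 := deriv_comp_mul_left a (fun s => (e (Φ.map (s + b, p))).2) t
  rw [smul_eq_mul, deriv_comp_add_const (fun s => (e (Φ.map (s, p))).2)] at h1
  exact h1

/-- A product of leaves has an orientation sign. -/
theorem exists_sign (hA : ∀ e ∈ A, V.IsFoliatedChart e) (hcov : ∀ x : M, ∃ e ∈ A, x ∈ e.source)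
    (hpos : ∀ e ∈ A, ∀ e' ∈ A, ∀ x ∈ e.source ∩ e'.source,
      0 < deriv (fun t : ℝ => (e' (e.symm ((e x).1, t))).2) (e x).2) :
    ∃ σ : ℝ, σ ≠ 0 ∧ ∀ e ∈ A, ∀ t p, Φ.map (t, p) ∈ e.source →
      0 < σ * deriv (fun s => (e (Φ.map (s, p))).2) t := by
  have hFc := Φ.connectedSpace
  set D : OpenPartialHomeomorph M (EuclideanSpace ℝ (Fin n) × ℝ) → ℝ × F → ℝ :=
    fun e z => deriv (fun s => (e (Φ.map (s, z.2))).2) z.1 with hD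
  -- `P 1` and `P (-1)` hold the points that some chart of `A` sees positively, respectively
  -- negatively, oriented. They are open, cover `ℝ × F`, and are disjoint by `hindep`, so
  -- connectedness leaves only one of them.
  set P : ℝ → Set (ℝ × F) := fun σ => {z | ∃ e ∈ A, Φ.map z ∈ e.source ∧ 0 < σ * D e z} with hP
  have hopen : ∀ σ, IsOpen (P σ) := by
    intro σ
    rw [isOpen_iff_mem_nhds]
    rintro ⟨t, p⟩ ⟨e, he, hz, hpos⟩
    -- Rather than proving `D e` continuous in both variables, use its reciprocal: `deriv H` at the
    -- transverse coordinate is continuous and has the same sign.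
    obtain ⟨O, J, H, hO, hxO, hOe, hJ, hH, h⟩ :=
      Φ.exists_height_eq_comp (hA e he) hz (mem_range_self _)
    have hone := fun t p => Φ.deriv_mul_deriv_eq_one (hA e he) hO hOe hJ hH h (t := t) (p := p)
    have hsign : ∀ {u v : ℝ}, u * v = 1 → (0 < σ * u ↔ 0 < σ * v) := by
      intro u v huv
      have hu : u ≠ 0 := left_ne_zero_of_mul_eq_one huv
      have : σ * u = (σ * v) * u ^ 2 := by linear_combination (-σ * u) * huv
      rw [this, mul_pos_iff_of_pos_right (by positivity)]
    have hcont : ContinuousAt (fun y => σ * deriv H (e y).2) (Φ.map (t, p)) := by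
      have h1 : ContinuousAt (deriv H) (e (Φ.map (t, p))).2 :=
        (hH.continuousOn_deriv_of_isOpen hJ (by simp)).continuousAt (hJ.mem_nhds (h _ hxO).1)
      have h2 : ContinuousAt (fun y => (e y).2) (Φ.map (t, p)) :=
        continuous_snd.continuousAt.comp (e.continuousAt hz)
      exact continuousAt_const.mul (h1.comp (f := fun y => (e y).2) h2)
    have hev := hcont.eventually (isOpen_Ioi.mem_nhds (show 0 < σ * deriv H _ from
      (hsign (hone t p hxO)).2 hpos))
    filter_upwards [Φ.continuous_map.continuousAt.eventually (hev.and (hO.mem_nhds hxO))]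
    rintro ⟨t', p'⟩ ⟨h1, h2⟩
    exact ⟨e, he, hOe h2, (hsign (hone t' p' h2)).1 h1⟩
  have hindep : ∀ e ∈ A, ∀ e' ∈ A, ∀ z, Φ.map z ∈ e.source → Φ.map z ∈ e'.source →
      ∃ k > 0, D e' z = k * D e z := by
    rintro e he e' he' ⟨t, p⟩ hz hz'
    refine ⟨_, hpos e he e' he' _ ⟨hz, hz'⟩, ?_⟩
    have hev := (hA e he).eventually_eq_comp (hA e' he') hz hz'
    have hev' := (Φ.continuous_curve p).continuousAt.eventually hev
    have heq : (fun s => (e' (Φ.map (s, p))).2) =ᶠ[𝓝 t]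
        (fun s => (e' (e.symm ((e (Φ.map (t, p))).1, s))).2) ∘ fun s => (e (Φ.map (s, p))).2 :=
      hev'
    simp only [hD]
    rw [heq.deriv_eq]
    refine deriv_comp t ?_ (Φ.differentiableAt_snd (hA e he) hz)
    exact differentiableAt_of_deriv_ne_zero (hpos e he e' he' _ ⟨hz, hz'⟩).ne'
  have hne : ∀ e ∈ A, ∀ z, Φ.map z ∈ e.source → D e z ≠ 0 := by
    rintro e he ⟨t, p⟩ hz
    obtain ⟨O, J, H, hO, hxO, hOe, hJ, hH, h⟩ :=
      Φ.exists_height_eq_comp (hA e he) hz (mem_range_self _)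
    exact right_ne_zero_of_mul_eq_one (Φ.deriv_mul_deriv_eq_one (hA e he) hO hOe hJ hH h hxO)
  have hcover : (univ : Set (ℝ × F)) ⊆ P 1 ∪ P (-1) := by
    intro z _
    obtain ⟨e, he, hz⟩ := hcov (Φ.map z)
    rcases (hne e he z hz).lt_or_gt with h | h
    · exact Or.inr ⟨e, he, hz, by linarith⟩
    · exact Or.inl ⟨e, he, hz, by linarith⟩
  have hall : ∀ σ : ℝ, P (-σ) = ∅ → σ ≠ 0 → (univ : Set (ℝ × F)) ⊆ P σ ∪ P (-σ) →
      ∀ e ∈ A, ∀ t p, Φ.map (t, p) ∈ e.source →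
      0 < σ * deriv (fun s => (e (Φ.map (s, p))).2) t := by
    intro σ hσ hσ0 hcov e he t p hz
    by_contra hle
    have h2 := mul_ne_zero hσ0 (hne e he (t, p) hz)
    have : (t, p) ∈ P (-σ) := ⟨e, he, hz, by
      have := lt_of_le_of_ne (not_lt.1 hle) h2
      simp only [hD]
      linarith⟩
    rw [hσ] at this
    exact this
  rcases (P (-1)).eq_empty_or_nonempty with hN | hN
  · exact ⟨1, one_ne_zero, hall 1 hN one_ne_zero hcover⟩
  · refine ⟨-1, by norm_num, hall (-1) ?_ (by norm_num) (by rwa [neg_neg, union_comm])⟩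
    rw [neg_neg]
    by_contra hP1
    obtain ⟨z, -, ⟨e, he, hz, h1⟩, e', he', hz', h2⟩ := isPreconnected_univ (α := ℝ × F) (P 1)
      (P (-1)) (hopen _) (hopen _) hcover (by simpa using nonempty_iff_ne_empty.2 hP1)
      (by simpa using hN)
    obtain ⟨k, hk, hkD⟩ := hindep e he e' he' z hz hz'
    rw [hkD] at h2
    nlinarith [mul_pos hk (by linarith : 0 < D e z)]

/-- Every point in the range of a product of leaves has height `1 / 2` in an oriented one. -/
theorem exists_isOriented (hV : ∃ σ : ℝ, σ ≠ 0 ∧ ∀ e ∈ A, ∀ t p, Φ.map (t, p) ∈ e.source →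
      0 < σ * deriv (fun s => (e (Φ.map (s, p))).2) t) {x : M} (hx : x ∈ range Φ.map) :
    ∃ Ψ : V.LeafProduct F, Ψ.IsOriented A ∧ ∃ p, Ψ.map (1 / 2, p) = x := by
  obtain ⟨σ, hσ, h⟩ := hV
  obtain ⟨⟨t, p⟩, rfl⟩ := hx
  -- Scaling by `σ`, possibly negative, corrects the orientation; the shift sends `1 / 2` to `t`.
  refine ⟨Φ.reparam σ (t - σ * (1 / 2)) hσ, fun e he s q hs => ?_, p, ?_⟩
  · rw [deriv_reparam]
    exact h e he _ q hs
  · change Φ.map (_, _) = _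
    simp

/-- The height of an oriented product increases along an oriented product. -/
theorem IsOriented.deriv_height_pos {Φ : V.LeafProduct F} (hΦ : Φ.IsOriented A)
    {Φ' : V.LeafProduct F} (hΦ' : Φ'.IsOriented A) (hA : ∀ e ∈ A, V.IsFoliatedChart e)
    (hcov : ∀ x : M, ∃ e ∈ A, x ∈ e.source) {t : ℝ} {p : F}
    (hx : Φ.map (t, p) ∈ range Φ'.map) :
    0 < deriv (fun s => Φ'.height (Φ.map (s, p))) t := by
  obtain ⟨e, he, hxe⟩ := hcov (Φ.map (t, p))
  obtain ⟨O, J, H, hO, hxO, hOe, hJ, hH, h⟩ := Φ'.exists_height_eq_comp (hA e he) hxe hx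
  obtain ⟨⟨t', p'⟩, hx'⟩ := hx
  have hone := Φ'.deriv_mul_deriv_eq_one (hA e he) hO hOe hJ hH h (t := t') (p := p') (hx' ▸ hxO)
  rw [hx'] at hone
  have hp' := hΦ' e he t' p' (hx' ▸ hxe)
  have hp := hΦ e he t p hxe
  have hHpos : 0 < deriv H (e (Φ.map (t, p))).2 := by
    by_contra hle
    nlinarith
  have heq : (fun s => Φ'.height (Φ.map (s, p))) =ᶠ[𝓝 t] H ∘ fun s => (e (Φ.map (s, p))).2 := by
    filter_upwards [(Φ.continuous_curve p).continuousAt.preimage_mem_nhds (hO.mem_nhds hxO)]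
      with s hs
    exact (h _ hs).2
  rw [heq.deriv_eq, deriv_comp t ((hH.contDiffAt (hJ.mem_nhds (h _ hxO).1)).differentiableAt
    (by simp)) (Φ.differentiableAt_snd (hA e he) hxe)]
  exact mul_pos hHpos hp

end LeafProduct

end CodimOneFoliation

/-! ### The circle-valued submersion -/

theorem expNegInvGlue.hasDerivAt_of_pos {x : ℝ} (hx : 0 < x) :
    HasDerivAt expNegInvGlue (Real.exp (-x⁻¹) * (x ^ 2)⁻¹) x := by
  have h1 : HasDerivAt (fun y : ℝ => Real.exp (-y⁻¹)) (Real.exp (-x⁻¹) * (x ^ 2)⁻¹) x := by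
    have := ((hasDerivAt_inv hx.ne').neg).exp
    simpa using this
  refine h1.congr_of_eventuallyEq ?_
  filter_upwards [lt_mem_nhds hx] with y hy
  simp [expNegInvGlue, not_le.2 hy]

/-- The transition is `a / (a + b)` with `a = expNegInvGlue x` and `b = expNegInvGlue (1 - x)`. The
numerator of its derivative is `a' b - a b'`, with `a' > 0` and `b' < 0` on `(0, 1)`. -/
theorem Real.smoothTransition.deriv_pos {x : ℝ} (h0 : 0 < x) (h1 : x < 1) :
    0 < deriv Real.smoothTransition x := by
  have hx1 : 0 < 1 - x := by linarith
  have ha := expNegInvGlue.hasDerivAt_of_pos h0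
  have hb := (expNegInvGlue.hasDerivAt_of_pos hx1).comp x ((hasDerivAt_id x).const_sub 1)
  have hd := ha.div (ha.add hb) (Real.smoothTransition.pos_denom x).ne'
  have hd' : HasDerivAt Real.smoothTransition _ x := hd
  rw [hd'.deriv]
  have pa := expNegInvGlue.pos_of_pos h0
  have pb := expNegInvGlue.pos_of_pos hx1
  have qa : 0 < Real.exp (-x⁻¹) * (x ^ 2)⁻¹ := by positivity
  have qb : 0 < Real.exp (-(1 - x)⁻¹) * ((1 - x) ^ 2)⁻¹ := by positivity
  have hpos := Real.smoothTransition.pos_denom x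
  refine div_pos ?_ (by
    simp only [Pi.add_apply, Function.comp_apply]
    positivity)
  simp only [Pi.add_apply, Function.comp_apply]
  nlinarith [mul_pos qa pb, mul_pos pa qb]

theorem Real.smoothTransition.deriv_nonneg (x : ℝ) : 0 ≤ deriv Real.smoothTransition x :=
  Real.smoothTransition.monotone.deriv_nonneg

theorem Circle.exp_sum {ι : Type*} (T : Finset ι) (v : ι → ℝ) :
    Circle.exp (∑ i ∈ T, v i) = ∏ i ∈ T, Circle.exp (v i) := by
  classical
  induction T using Finset.induction_on with
  | empty => simp
  | insert a s ha ih => rw [Finset.sum_insert ha, Finset.prod_insert ha, Circle.exp_add, ih]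

namespace CodimOneFoliation

variable {n : ℕ} {M : Type u} [TopologicalSpace M]
  [ChartedSpace (EuclideanSpace ℝ (Fin (n + 1))) M]

namespace LeafProduct

variable {V : CodimOneFoliation n M} {F : Type*} [TopologicalSpace F]
  [ChartedSpace (EuclideanSpace ℝ (Fin n)) F] (Φ : V.LeafProduct F)

open Classical in
/-- The circle valued function, constant on the leaves, which winds once around the circle
while the height goes from `0` to `1`, and which is constant elsewhere. -/
noncomputable def winding (x : M) : Circle :=
  if x ∈ range Φ.map then Circle.exp (2 * Real.pi * Real.smoothTransition (Φ.height x)) else 1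

theorem winding_of_mem {x : M} (hx : x ∈ range Φ.map) :
    Φ.winding x = Circle.exp (2 * Real.pi * Real.smoothTransition (Φ.height x)) := if_pos hx

theorem winding_of_notMem {x : M} (hx : x ∉ range Φ.map) : Φ.winding x = 1 := if_neg hx

/-- The transition is `0` below height `0` and `1` above height `1`, and both ends go to `1` on the
circle. This is what makes the extension by `1` smooth. -/
theorem winding_eq_one {x : M} (hx : x ∉ Φ.map '' (Icc 0 1 ×ˢ univ)) : Φ.winding x = 1 := by
  by_cases h : x ∈ range Φ.map
  · rw [Φ.winding_of_mem h]
    by_cases h0 : Φ.height x ≤ 0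
    · rw [Real.smoothTransition.zero_of_nonpos h0, mul_zero, Circle.exp_zero]
    · by_cases h1 : 1 ≤ Φ.height x
      · rw [Real.smoothTransition.one_of_one_le h1, mul_one, Circle.exp_two_pi]
      · exact absurd ⟨_, ⟨⟨(not_le.1 h0).le, (not_le.1 h1).le⟩, trivial⟩, Φ.map_height_proj h⟩ hx
  · exact Φ.winding_of_notMem h

theorem winding_eq_of_leaf_eq {x y : M} (h : V.leaf x = V.leaf y) :
    Φ.winding x = Φ.winding y := by
  have key : ∀ {x y : M}, V.leaf x = V.leaf y → x ∈ range Φ.map → y ∈ range Φ.map :=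
    fun {x y} h hx => Φ.leaf_subset_range hx (h ▸ V.mem_leaf y)
  by_cases hx : x ∈ range Φ.map
  · have hy := key h hx
    rw [Φ.winding_of_mem hx, Φ.winding_of_mem hy, (Φ.leaf_eq_iff hx hy).1 h]
  · have hy : y ∉ range Φ.map := fun hy => hx (key h.symm hy)
    rw [Φ.winding_of_notMem hx, Φ.winding_of_notMem hy]

variable {A : Set (OpenPartialHomeomorph M (EuclideanSpace ℝ (Fin n) × ℝ))}

/-- Local logarithms of the winding function are nondecreasing in the positive direction. -/
theorem exists_local_log [T2Space M] {Φ : V.LeafProduct F} (hΦ : Φ.IsOriented A)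
    (hA : ∀ e ∈ A, V.IsFoliatedChart e) (hcov : ∀ x : M, ∃ e ∈ A, x ∈ e.source) (x₀ : M) :
    ∃ (O : Set M) (v : M → ℝ), IsOpen O ∧ x₀ ∈ O ∧ ContMDiffOn (𝓡 (n + 1)) 𝓘(ℝ, ℝ) ∞ v O ∧
      v x₀ = 0 ∧ (∀ x ∈ O, Φ.winding x = Φ.winding x₀ * Circle.exp (v x)) ∧
      ∀ Ψ : V.LeafProduct F, Ψ.IsOriented A → ∀ t p, Ψ.map (t, p) ∈ O →
        0 ≤ deriv (fun s => v (Ψ.map (s, p))) t ∧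
        (Ψ.map (t, p) ∈ Φ.map '' (Ioo 0 1 ×ˢ univ) →
          0 < deriv (fun s => v (Ψ.map (s, p))) t) := by
  by_cases hx₀ : x₀ ∈ range Φ.map
  · refine ⟨range Φ.map, fun x => 2 * Real.pi * Real.smoothTransition (Φ.height x) -
      2 * Real.pi * Real.smoothTransition (Φ.height x₀), Φ.isOpen_range, hx₀, ?_, by simp, ?_, ?_⟩
    · have h1 : ContMDiff 𝓘(ℝ, ℝ) 𝓘(ℝ, ℝ) ∞ fun s : ℝ => 2 * Real.pi * Real.smoothTransition s -
          2 * Real.pi * Real.smoothTransition (Φ.height x₀) := by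
        rw [contMDiff_iff_contDiff]
        exact (contDiff_const.mul Real.smoothTransition.contDiff).sub contDiff_const
      exact h1.comp_contMDiffOn Φ.contMDiffOn_height
    · intro x hx
      rw [Φ.winding_of_mem hx, Φ.winding_of_mem hx₀, ← Circle.exp_add]
      congr 1
      ring
    · intro Ψ hΨ t p hx
      have hd := hΨ.deriv_height_pos hΦ hA hcov hx
      have hd' : HasDerivAt (fun s => Φ.height (Ψ.map (s, p))) _ t :=
        (differentiableAt_of_deriv_ne_zero hd.ne').hasDerivAt
      have hs : HasDerivAt Real.smoothTransition _ (Φ.height (Ψ.map (t, p))) :=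
        ((Real.smoothTransition.contDiffAt (n := 1)).differentiableAt (by simp)).hasDerivAt
      have hc := (((hs.comp t hd').const_mul (2 * Real.pi)).sub_const
        (2 * Real.pi * Real.smoothTransition (Φ.height x₀))).deriv
      simp only [Function.comp_def] at hc
      rw [hc]
      have hnn := Real.smoothTransition.deriv_nonneg (Φ.height (Ψ.map (t, p)))
      refine ⟨by positivity, ?_⟩
      rintro ⟨⟨s, q⟩, ⟨hs, -⟩, hsq⟩
      have hpos := Real.smoothTransition.deriv_pos hs.1 hs.2
      rw [← hsq, Φ.height_map]
      positivity
  -- Since `F` is compact, the part of height in `[0, 1]` is closed in `M`. Off it the winding is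
  -- constantly `1`, with logarithm `0`.
  · have hFc := Φ.compactSpace
    have hK : IsClosed (Φ.map '' (Icc 0 1 ×ˢ univ)) :=
      ((isCompact_Icc.prod isCompact_univ).image Φ.continuous_map).isClosed
    refine ⟨(Φ.map '' (Icc 0 1 ×ˢ univ))ᶜ, fun _ => 0, hK.isOpen_compl, ?_, contMDiffOn_const, rfl,
      ?_, ?_⟩
    · exact fun h => hx₀ (image_subset_range _ _ h)
    · intro x hx
      rw [Φ.winding_eq_one hx, Φ.winding_of_notMem hx₀, Circle.exp_zero, mul_one]
    · intro Ψ _ t p hx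
      refine ⟨by simp, fun h => absurd (image_mono (prod_mono_left Ioo_subset_Icc_self) h) hx⟩

end LeafProduct

/-- If products of leaves cover `M`, there is a circle valued submersion constant on the leaves. -/
theorem TransversallyOrientable.exists_submersion [T2Space M] [CompactSpace M]
    {V : CodimOneFoliation n M} (hV : V.TransversallyOrientable) {F : Type*} [TopologicalSpace F]
    [ChartedSpace (EuclideanSpace ℝ (Fin n)) F]
    (hF : ∀ x : M, ∃ Φ : V.LeafProduct F, x ∈ range Φ.map) :
    ∃ f : M → Circle, (∀ x y, V.leaf x = V.leaf y → f x = f y) ∧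
      ∀ x₀, ∃ (Ψ : V.LeafProduct F) (t₀ : ℝ) (p₀ : F) (O : Set M) (v : M → ℝ),
        Ψ.map (t₀, p₀) = x₀ ∧ IsOpen O ∧ x₀ ∈ O ∧ ContMDiffOn (𝓡 (n + 1)) 𝓘(ℝ, ℝ) ∞ v O ∧
        v x₀ = 0 ∧ (∀ x ∈ O, f x = f x₀ * Circle.exp (v x)) ∧
        ∀ t p, Ψ.map (t, p) ∈ O → 0 < deriv (fun s => v (Ψ.map (s, p))) t := by
  obtain ⟨A, hA, hcov, hpos⟩ := hV
  have hor : ∀ x : M, ∃ Ψ : V.LeafProduct F, Ψ.IsOriented A ∧ ∃ p, Ψ.map (1 / 2, p) = x := by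
    intro x
    obtain ⟨Φ, hΦ⟩ := hF x
    exact Φ.exists_isOriented (Φ.exists_sign hA hcov hpos) hΦ
  choose Ψ hΨ p hp using hor
  -- Every point has height `1 / 2` in its own product, so the parts of height in `(0, 1)` cover
  -- `M`. Hence at each point some factor of the finite product has strictly positive logarithmic
  -- derivative, and the others contribute nonnegatively.
  obtain ⟨T, -, hT⟩ := (isCompact_univ (X := M)).elim_nhds_subcover
    (fun x => (Ψ x).map '' (Ioo 0 1 ×ˢ univ)) fun x _ =>
    ((Ψ x).isOpenEmbedding_map.isOpenMap _ (isOpen_Ioo.prod isOpen_univ)).mem_nhds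
      ⟨(1 / 2, p x), ⟨⟨by norm_num, by norm_num⟩, trivial⟩, hp x⟩
  refine ⟨fun x => ∏ i ∈ T, (Ψ i).winding x, fun x y h =>
    Finset.prod_congr rfl fun i _ => (Ψ i).winding_eq_of_leaf_eq h, fun x₀ => ?_⟩
  choose O v hO hx₀ hv hv0 hw hd using fun i => LeafProduct.exists_local_log (hΨ i) hA hcov x₀
  refine ⟨Ψ x₀, 1 / 2, p x₀, ⋂ i ∈ T, O i, fun x => ∑ i ∈ T, v i x, hp x₀,
    isOpen_biInter_finset fun i _ => hO i, mem_iInter₂.2 fun i _ => hx₀ i, ?_, ?_, ?_, ?_⟩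
  · exact contMDiffOn_finsetSum fun i hi => (hv i).mono (biInter_subset_of_mem hi)
  · simp [hv0]
  · intro x hx
    rw [Circle.exp_sum, ← Finset.prod_mul_distrib]
    exact Finset.prod_congr rfl fun i hi => hw i x (mem_iInter₂.1 hx i hi)
  · intro t q hx
    have hx' := fun i hi => mem_iInter₂.1 hx i hi
    have hdiff : ∀ i ∈ T, DifferentiableAt ℝ (fun s => v i ((Ψ x₀).map (s, q))) t := fun i hi =>
      ((Ψ x₀).contDiffAt_curve ((hv i).contMDiffAt ((hO i).mem_nhds (hx' i hi)))).differentiableAt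
        (by simp)
    rw [deriv_fun_sum hdiff]
    obtain ⟨i, hi, hiT⟩ := mem_iUnion₂.1 (hT (mem_univ ((Ψ x₀).map (t, q))))
    exact Finset.sum_pos' (fun j hj => (hd j _ (hΨ x₀) t q (hx' j hj)).1)
      ⟨i, hi, (hd i _ (hΨ x₀) t q (hx' i hi)).2 hiT⟩

end CodimOneFoliation

/-! ### The leaf space is a circle -/

/-- A compact connected space with a local homeomorphism `f` to the circle is homeomorphic to the
circle, in such a way that `f` becomes a power map. -/
theorem IsLocalHomeomorph.exists_root {Q : Type*} [TopologicalSpace Q] [T2Space Q] [CompactSpace Q]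
    [ConnectedSpace Q] {f : Q → Circle} (hf : IsLocalHomeomorph f) :
    ∃ (m : ℕ) (g : Q → Circle), 0 < m ∧ Continuous g ∧ Function.Bijective g ∧
      ∀ q, g q ^ m = f q := by
  have cov := isLocalHomeomorph_iff_isCoveringMap.1 hf
  obtain ⟨q₀⟩ := (inferInstance : Nonempty Q)
  obtain ⟨a₀, ha₀⟩ := Circle.exp_surjective (f q₀)
  -- Lift `Circle.exp` through the covering `f` to a line `γ` in `Q`. By uniqueness of lifts, a
  -- single coincidence of `γ` with a translate by a multiple of `2π` makes that translation a
  -- period.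
  obtain ⟨γ, ⟨hγ₀, hγf⟩, -⟩ := cov.existsUnique_continuousMap_lifts Circle.exp a₀ q₀ ha₀.symm
  have hγ : ∀ t, f (γ t) = Circle.exp t := fun t => congrFun hγf t
  have hexp : ∀ (t : ℝ) (k : ℤ), Circle.exp (t + k * (2 * Real.pi)) = Circle.exp t := fun t k =>
    Circle.exp_eq_exp.2 ⟨k, rfl⟩
  have hper : ∀ (k : ℤ) (t : ℝ), γ (t + k * (2 * Real.pi)) = γ t →
      Function.Periodic γ (k * (2 * Real.pi)) := by
    intro k t h
    have h1 : Continuous fun s => γ (s + k * (2 * Real.pi)) := by fun_prop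
    refine congrFun (cov.eq_of_comp_eq h1 γ.continuous (funext fun s => ?_) t h)
    simp only [Function.comp_apply, hγ, hexp]
  -- The fibre of `f` is compact and discrete, hence finite, so `γ` must return to a point of it.
  have hex : ∃ k : ℕ, 0 < k ∧ Function.Periodic γ ((k : ℤ) * (2 * Real.pi)) := by
    have : DiscreteTopology (f ⁻¹' {f q₀}) := (cov (f q₀)).discreteTopology_fiber
    have : CompactSpace (f ⁻¹' {f q₀}) := isCompact_iff_compactSpace.1
      (isClosed_singleton.preimage hf.continuous).isCompact
    have : Finite (f ⁻¹' {f q₀}) := finite_of_compact_of_discrete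
    have hmem : ∀ k : ℕ, γ (a₀ + (k : ℤ) * (2 * Real.pi)) ∈ f ⁻¹' {f q₀} := fun k => by
      rw [mem_preimage, hγ, hexp, ha₀]; rfl
    obtain ⟨i, j, hij, h⟩ := Finite.exists_ne_map_eq_of_infinite
      fun k : ℕ => (⟨_, hmem k⟩ : f ⁻¹' {f q₀})
    have h' : γ (a₀ + (i : ℤ) * (2 * Real.pi)) = γ (a₀ + (j : ℤ) * (2 * Real.pi)) :=
      congrArg Subtype.val h
    have key : ∀ i j : ℕ, i < j →
        γ (a₀ + (i : ℤ) * (2 * Real.pi)) = γ (a₀ + (j : ℤ) * (2 * Real.pi)) →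
        ∃ k : ℕ, 0 < k ∧ Function.Periodic γ ((k : ℤ) * (2 * Real.pi)) := by
      intro i j hij h
      refine ⟨j - i, Nat.sub_pos_of_lt hij, hper _ (a₀ + (i : ℤ) * (2 * Real.pi)) ?_⟩
      rw [h]
      congr 1
      push_cast [Nat.cast_sub hij.le]
      ring
    rcases hij.lt_or_gt with hlt | hlt
    · exact key i j hlt h'
    · exact key j i hlt h'.symm
  classical
  set m := Nat.find hex with hm
  obtain ⟨hm0, hmper⟩ := Nat.find_spec hex
  rw [← hm] at hm0 hmper
  have hm0' : (0 : ℝ) < m := by exact_mod_cast hm0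
  have hdvd : ∀ k : ℤ, Function.Periodic γ (k * (2 * Real.pi)) → (m : ℤ) ∣ k := by
    intro k hk
    by_contra hnd
    have hmz : (0 : ℤ) < m := by exact_mod_cast hm0
    have hr0 : 0 < k % m := lt_of_le_of_ne (Int.emod_nonneg _ hmz.ne')
      (fun h => hnd (Int.dvd_of_emod_eq_zero h.symm))
    have hlt := Int.emod_lt_of_pos k hmz
    obtain ⟨r, hr⟩ := Int.eq_ofNat_of_zero_le hr0.le
    have hP : Function.Periodic γ ((r : ℤ) * (2 * Real.pi)) := by
      have h2 := hk.sub_period (hmper.int_mul (k / m))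
      have hk' : (k : ℝ) = m * (k / m : ℤ) + (r : ℤ) := by
        have := (Int.mul_ediv_add_emod k m).symm
        rw [hr] at this
        exact_mod_cast this
      have h3 : ((r : ℤ) : ℝ) * (2 * Real.pi) =
          k * (2 * Real.pi) - ((k / m : ℤ) : ℝ) * (((m : ℤ) : ℝ) * (2 * Real.pi)) := by
        rw [hk']
        push_cast
        ring
      rw [h3]
      exact h2
    exact Nat.find_min hex (m := r) (by omega) ⟨by omega, hP⟩
  have hinj : ∀ s t, γ s = γ t → ∃ k : ℤ, s = t + k * (m * (2 * Real.pi)) := by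
    intro s t h
    have h1 : Circle.exp s = Circle.exp t := by rw [← hγ, ← hγ, h]
    obtain ⟨k, rfl⟩ := Circle.exp_eq_exp.1 h1
    obtain ⟨l, rfl⟩ := hdvd k (hper k t h)
    exact ⟨l, by push_cast; ring⟩
  have hloc : IsLocalHomeomorph γ := by
    refine IsLocalHomeomorph.of_comp (g := f) ?_ hf γ.continuous
    rw [hγf]
    exact isLocalHomeomorph_circleExp
  have hsurj : Function.Surjective γ := by
    have hpos : 0 < ((m : ℤ) : ℝ) * (2 * Real.pi) := by
      have := Real.pi_pos
      push_cast
      positivity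
    have hrange : range γ = γ '' Icc 0 (0 + ((m : ℤ) : ℝ) * (2 * Real.pi)) :=
      (hmper.image_Icc hpos 0).symm
    rw [← range_eq_univ]
    refine IsClopen.eq_univ ⟨?_, hloc.isOpenMap.isOpen_range⟩ (range_nonempty _)
    rw [hrange]
    exact (isCompact_Icc.image γ.continuous).isClosed
  -- With `m` the least period in units of `2π`, `γ` identifies `Q` with `ℝ / 2πmℤ`. So `Circle.exp
  -- (τ q / m)` does not depend on the choice of the parameter `τ q`, and its `m`-th power is `f q`.
  choose τ hτ using hsurj
  have hval : ∀ t, Circle.exp (τ (γ t) / m) = Circle.exp (t / m) := by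
    intro t
    obtain ⟨k, hk⟩ := hinj _ _ (hτ (γ t))
    rw [hk, Circle.exp_eq_exp]
    refine ⟨k, ?_⟩
    field_simp
  refine ⟨m, fun q => Circle.exp (τ q / m), hm0, ?_, ⟨?_, ?_⟩, ?_⟩
  · rw [(hloc.isOpenMap.isQuotientMap γ.continuous fun q => ⟨_, hτ q⟩).continuous_iff]
    have : (fun q => Circle.exp (τ q / m)) ∘ γ = fun t : ℝ => Circle.exp (t / m) :=
      funext hval
    rw [this]
    fun_prop
  · intro q q' h
    obtain ⟨k, hk⟩ := Circle.exp_eq_exp.1 h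
    have : τ q = τ q' + k * ((m : ℤ) * (2 * Real.pi)) := by
      field_simp at hk
      push_cast
      linear_combination hk
    rw [← hτ q, ← hτ q', this]
    exact hmper.int_mul k (τ q')
  · intro c
    obtain ⟨s, rfl⟩ := Circle.exp_surjective c
    refine ⟨γ (m * s), ?_⟩
    refine (hval _).trans ?_
    congr 1
    field_simp
  · intro q
    rw [← Circle.exp_nsmul]
    conv_rhs => rw [← hτ q, hγ]
    congr 1
    rw [nsmul_eq_mul]
    field_simp

namespace CodimOneFoliation

variable {n : ℕ} {M : Type u} [TopologicalSpace M]
  [ChartedSpace (EuclideanSpace ℝ (Fin (n + 1))) M]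

section Local

variable {V : CodimOneFoliation n M} {F : Type*} [TopologicalSpace F]
  [ChartedSpace (EuclideanSpace ℝ (Fin n)) F] (Ψ : V.LeafProduct F) {O : Set M} {v : M → ℝ}

theorem LeafProduct.contDiffOn_curve (hO : IsOpen O) (hv : ContMDiffOn (𝓡 (n + 1)) 𝓘(ℝ, ℝ) ∞ v O)
    (p : F) :
    ContDiffOn ℝ ∞ (fun s => v (Ψ.map (s, p))) {s | Ψ.map (s, p) ∈ O} := fun _ hs =>
  (Ψ.contDiffAt_curve (hv.contMDiffAt (hO.mem_nhds hs))).contDiffWithinAt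

/-- A function with positive derivative along the curves transverse to the leaves restricts to a
smooth coordinate on these curves. -/
theorem LeafProduct.exists_coordinate (hO : IsOpen O)
    (hv : ContMDiffOn (𝓡 (n + 1)) 𝓘(ℝ, ℝ) ∞ v O) {t₀ : ℝ} {p₀ : F} (ht₀ : Ψ.map (t₀, p₀) ∈ O)
    (hd : ∀ t p, Ψ.map (t, p) ∈ O → 0 < deriv (fun s => v (Ψ.map (s, p))) t) :
    ∃ h : OpenPartialHomeomorph ℝ ℝ, t₀ ∈ h.source ∧ (∀ s ∈ h.source, Ψ.map (s, p₀) ∈ O) ∧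
      (∀ s, h s = v (Ψ.map (s, p₀))) ∧ ContDiffOn ℝ ∞ h h.source ∧
      ContDiffOn ℝ ∞ h.symm h.target := by
  have hW : IsOpen {s | Ψ.map (s, p₀) ∈ O} := hO.preimage (Ψ.continuous_curve p₀)
  have hcd := Ψ.contDiffOn_curve hO hv p₀
  have hcd' : ∀ s, Ψ.map (s, p₀) ∈ O → ContDiffAt ℝ ∞ (fun s => v (Ψ.map (s, p₀))) s :=
    fun s hs => hcd.contDiffAt (hW.mem_nhds hs)
  have hdv : ∀ s, Ψ.map (s, p₀) ∈ O → HasDerivAt (fun s => v (Ψ.map (s, p₀)))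
      (deriv (fun s => v (Ψ.map (s, p₀))) s) s := fun s hs =>
    ((hcd' s hs).differentiableAt (by simp)).hasDerivAt
  have hd₀ := (hdv t₀ ht₀).hasFDerivAt_equiv (hd t₀ p₀ ht₀).ne'
  let e := (hcd' t₀ ht₀).toOpenPartialHomeomorph (fun s => v (Ψ.map (s, p₀))) hd₀ (by simp)
  have he : ∀ s, e s = v (Ψ.map (s, p₀)) := fun s => rfl
  have hsrc : t₀ ∈ e.source :=
    (hcd' t₀ ht₀).mem_toOpenPartialHomeomorph_source hd₀ (by simp)
  have hmem : ∀ s ∈ (e.restrOpen _ hW).source, Ψ.map (s, p₀) ∈ O := fun s hs => by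
    rw [e.restrOpen_source] at hs
    exact hs.2
  refine ⟨e.restrOpen _ hW, ?_, hmem, he, hcd.mono hmem, fun s hs => ?_⟩
  · rw [e.restrOpen_source]
    exact ⟨hsrc, ht₀⟩
  · have hs' := hmem _ ((e.restrOpen _ hW).map_target hs)
    exact ((e.restrOpen _ hW).contDiffAt_symm_deriv (hd _ p₀ hs').ne' hs (hdv _ hs')
      (hcd' _ hs')).contDiffWithinAt

end Local

/-- If products of leaves cover `M`, a circle valued submersion constant on the leaves has a root
whose fibres are the leaves. -/
theorem exists_root_of_submersion [T2Space M] [CompactSpace M] [ConnectedSpace M]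
    {V : CodimOneFoliation n M} {F : Type*} [TopologicalSpace F]
    [ChartedSpace (EuclideanSpace ℝ (Fin n)) F]
    (hF : ∀ x : M, ∃ Φ : V.LeafProduct F, x ∈ range Φ.map)
    {f : M → Circle} (hf : ∀ x y, V.leaf x = V.leaf y → f x = f y)
    (hfl : ∀ x₀, ∃ (Ψ : V.LeafProduct F) (t₀ : ℝ) (p₀ : F) (O : Set M) (v : M → ℝ),
        Ψ.map (t₀, p₀) = x₀ ∧ IsOpen O ∧ x₀ ∈ O ∧ ContMDiffOn (𝓡 (n + 1)) 𝓘(ℝ, ℝ) ∞ v O ∧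
        v x₀ = 0 ∧ (∀ x ∈ O, f x = f x₀ * Circle.exp (v x)) ∧
        ∀ t p, Ψ.map (t, p) ∈ O → 0 < deriv (fun s => v (Ψ.map (s, p))) t) :
    ∃ (m : ℕ) (g : M → Circle), 0 < m ∧ Continuous g ∧ Function.Surjective g ∧
      (∀ x y, g x = g y ↔ V.leaf x = V.leaf y) ∧ ∀ x, g x ^ m = f x := by
  let Q := Quotient (Setoid.ker V.leaf)
  let q : M → Q := Quotient.mk _
  have hq : ∀ x y, q x = q y ↔ V.leaf x = V.leaf y := fun x y => Quotient.eq
  have hqc : Continuous q := continuous_quotient_mk'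
  have hqs : Function.Surjective q := Quotient.mk_surjective
  have hqo : IsOpenMap q := by
    intro U hU
    have : IsOpen (q ⁻¹' (q '' U)) := by
      rw [isOpen_iff_mem_nhds]
      rintro x ⟨y, hy, hyx⟩
      rw [hq] at hyx
      obtain ⟨Φ, hΦ⟩ := hF x
      filter_upwards [Φ.eventually_leaf_inter hΦ hU ⟨y, hyx ▸ V.mem_leaf y, hy⟩] with z hz
      obtain ⟨w, hw, hwU⟩ := hz
      exact ⟨w, hwU, (hq _ _).2 (V.leaf_eq hw).symm⟩
    exact isQuotientMap_quotient_mk'.isOpen_preimage.1 this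
  have : CompactSpace Q := Quotient.compactSpace
  have : ConnectedSpace Q := hqs.connectedSpace hqc
  -- Two distinct leaves are disjoint and compact, so they have disjoint neighbourhoods in `M`, and
  -- nearby leaves stay inside these.
  have : T2Space Q := by
    rw [t2Space_iff_of_isOpenQuotientMap (π := q) ⟨hqs, hqc, hqo⟩, ← isOpen_compl_iff,
      isOpen_iff_mem_nhds]
    rintro ⟨x, y⟩ hxy
    have hne : V.leaf x ≠ V.leaf y := fun h => hxy ((hq x y).2 h)
    obtain ⟨Φ, hΦ⟩ := hF x
    obtain ⟨Φ', hΦ'⟩ := hF y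
    have hdisj : Disjoint (V.leaf x) (V.leaf y) := by
      rw [disjoint_left]
      intro z hzx hzy
      exact hne ((V.leaf_eq hzx).trans (V.leaf_eq hzy).symm)
    obtain ⟨O, O', hO, hO', hxO, hyO', hOO'⟩ :=
      SeparatedNhds.of_isCompact_isCompact
        (V.isCompact_of_leafTopology (Φ.isCompactLeaf_leaf hΦ).2)
        (V.isCompact_of_leafTopology (Φ'.isCompactLeaf_leaf hΦ').2) hdisj
    filter_upwards [prod_mem_nhds (Φ.eventually_leaf_subset hΦ hO hxO)
      (Φ'.eventually_leaf_subset hΦ' hO' hyO')]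
    rintro ⟨x', y'⟩ ⟨hx', hy'⟩ h
    have h' := (hq x' y').1 h
    exact disjoint_left.1 hOO' (hx' (V.mem_leaf x')) (hy' (h' ▸ V.mem_leaf x'))
  let fQ : Q → Circle := Quotient.lift f fun x y h => hf x y h
  have hloc : IsLocalHomeomorph fQ := by
    rw [isLocalHomeomorph_iff_isLocalHomeomorphOn_univ]
    intro z _
    obtain ⟨x₀, rfl⟩ := hqs z
    obtain ⟨Ψ, t₀, p₀, O, v, hx₀, hO, hx₀O, hv, hv0, hfv, hd⟩ := hfl x₀
    obtain ⟨h, ht₀, hhO, hhv, -, -⟩ := Ψ.exists_coordinate hO hv (hx₀ ▸ hx₀O) hd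
    -- A transverse curve meets each leaf of the product once, so it parametrizes an open part of
    -- `Q`. In this parameter `f` is `f x₀ * Circle.exp (h s)` near `t₀`.
    let σ : ℝ → Q := fun s => q (Ψ.map (s, p₀))
    have hσ : IsOpenEmbedding σ := by
      refine .of_continuous_injective_isOpenMap (hqc.comp (Ψ.continuous_curve p₀)) ?_ ?_
      · intro s t hst
        have := (Ψ.leaf_eq_iff (mem_range_self _) (mem_range_self _)).1 ((hq _ _).1 hst)
        rwa [Ψ.height_map, Ψ.height_map] at this
      · intro U hU
        have : σ '' U = q '' (Ψ.map '' (U ×ˢ univ)) := by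
          ext z
          constructor
          · rintro ⟨s, hs, rfl⟩
            exact ⟨_, ⟨(s, p₀), ⟨hs, trivial⟩, rfl⟩, rfl⟩
          · rintro ⟨_, ⟨⟨s, p⟩, ⟨hs, -⟩, rfl⟩, rfl⟩
            refine ⟨s, hs, (hq _ _).2 ?_⟩
            rw [Ψ.leaf_map, Ψ.leaf_map]
        rw [this]
        exact hqo _ (Ψ.isOpenEmbedding_map.isOpenMap _ (hU.prod isOpen_univ))
    have hcomp : IsLocalHomeomorphOn (fQ ∘ σ) {t₀} := by
      refine IsLocalHomeomorphOn.mk _ _ ?_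
      intro t ht
      rw [mem_singleton_iff.1 ht]
      obtain ⟨e, he, hee⟩ := isLocalHomeomorph_circleExp (h t₀)
      refine ⟨(h.trans e).trans (Homeomorph.mulLeft (f x₀)).toOpenPartialHomeomorph, ?_, ?_⟩
      · simp [ht₀, he]
      · intro s hs
        have hs' : s ∈ h.source := by
          simp at hs
          exact hs.1
        change f (Ψ.map (s, p₀)) = f x₀ * e (h s)
        rw [hfv _ (hhO s hs'), ← hee, hhv]
    have := hcomp.of_comp_right (hσ.isLocalHomeomorph.isLocalHomeomorphOn.mono (subset_univ _))
    exact this _ ⟨t₀, rfl, congrArg q hx₀⟩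
  obtain ⟨m, g, hm, hgc, ⟨hgi, hgs⟩, hgm⟩ := hloc.exists_root
  refine ⟨m, g ∘ q, hm, hgc.comp hqc, hgs.comp hqs, fun x y => ?_, fun x => hgm _⟩
  rw [Function.comp_apply, Function.comp_apply, hgi.eq_iff, hq]

end CodimOneFoliation

/-! ### Smooth roots and local trivializations -/

theorem Circle.contMDiffOn_arg :
    ContMDiffOn (𝓡 1) 𝓘(ℝ, ℝ) ∞ (fun c : Circle => Complex.arg c)
      {c : Circle | (c : ℂ) ∈ Complex.slitPlane} := by
  intro c hc
  have h1 : ContMDiff (𝓡 1) 𝓘(ℝ, ℂ) ∞ (fun c : Circle => (c : ℂ)) :=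
    haveI := finrank_real_complex_fact'
    contMDiff_coe_sphere
  have h2 : ContDiffAt ℝ ∞ (fun z : ℂ => Complex.arg z) c := by
    have h3 : ContDiffAt ℝ ∞ Complex.log c := (Complex.contDiffAt_log hc).restrict_scalars ℝ
    have h4 := (Complex.imCLM.contDiff (n := ∞)).contDiffAt.comp (c : ℂ) h3
    exact h4.congr_of_eventuallyEq (Filter.Eventually.of_forall fun z => (Complex.log_im z).symm)
  exact (h2.contMDiffAt.comp c (h1 c)).contMDiffWithinAt

theorem Circle.mem_slitPlane_of_arg_lt {c : Circle} (h : Complex.arg c < Real.pi) :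
    (c : ℂ) ∈ Complex.slitPlane :=
  Complex.mem_slitPlane_iff_arg.2 ⟨h.ne, c.coe_ne_zero⟩

theorem Circle.contMDiff_mul_left (b : Circle) : ContMDiff (𝓡 1) (𝓡 1) ∞ fun c : Circle => b * c :=
  (_root_.contMDiff_mul_left (I := 𝓡 1) (n := ω) (a := b)).of_le le_top

/-- Two roots of a nonvanishing circle valued function agreeing at a point agree near it. -/
theorem Circle.eventually_eq_of_pow_eq {X : Type*} [TopologicalSpace X] {g g' : X → Circle} {x : X}
    (hg : ContinuousAt g x) (hg' : ContinuousAt g' x) (hx : g x = g' x) {m : ℕ} (hm : 0 < m)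
    (h : ∀ᶠ y in 𝓝 x, g y ^ m = g' y ^ m) : ∀ᶠ y in 𝓝 x, g y = g' y := by
  have hfin : {z : Circle | z ^ m = 1}.Finite := by
    refine Set.Finite.of_finite_image (f := ((↑) : Circle → ℂ)) ?_ Circle.coe_injective.injOn
    refine ((Polynomial.nthRoots m (1 : ℂ)).toFinset.finite_toSet).subset ?_
    rintro _ ⟨z, hz, rfl⟩
    rw [Finset.mem_coe, Multiset.mem_toFinset, Polynomial.mem_nthRoots hm, ← Circle.coe_pow, hz,
      Circle.coe_one]
  -- The quotient `g / g'` is continuous at `x`, takes the value `1` there and is nearby an `m`-th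
  -- root of unity; `1` is isolated among these finitely many roots.
  have hU : ({z : Circle | z ^ m = 1} \ {1})ᶜ ∈ 𝓝 (g x / g' x) := by
    rw [hx, div_self']
    exact (hfin.subset sdiff_subset).isClosed.isOpen_compl.mem_nhds (by simp)
  filter_upwards [h, (hg.div' hg').preimage_mem_nhds hU] with y hy hy'
  by_contra hne
  refine hy' ⟨?_, fun h1 => hne (div_eq_one.1 h1)⟩
  change (g y / g' y) ^ m = 1
  rw [div_pow, hy, div_self']

namespace CodimOneFoliation

variable {n : ℕ} {M : Type u} [TopologicalSpace M]
  [ChartedSpace (EuclideanSpace ℝ (Fin (n + 1))) M]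

/-- A product of leaves trivializes a map whose fibres are the leaves. -/
theorem LeafProduct.exists_trivialization {V : CodimOneFoliation n M} {F : Type*}
    [TopologicalSpace F] [ChartedSpace (EuclideanSpace ℝ (Fin n)) F] (Ψ : V.LeafProduct F)
    {g : M → Circle} (hg : ContMDiff (𝓡 (n + 1)) (𝓡 1) ∞ g)
    (hgl : ∀ x y, g x = g y ↔ V.leaf x = V.leaf y) {h : OpenPartialHomeomorph ℝ ℝ}
    (hh : ContDiffOn ℝ ∞ h.symm h.target) (hπ : h.target ⊆ Ioo (-Real.pi) Real.pi) {b : Circle}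
    (hb : ∀ s ∈ h.source, ∀ p, g (Ψ.map (s, p)) = b * Circle.exp (h s)) :
    ∃ e : Bundle.Trivialization F g, e.baseSet = (fun s => b * Circle.exp s) '' h.target ∧
      ContMDiffOn (𝓡 (n + 1)) ((𝓡 1).prod (𝓡 n)) ∞ e e.source ∧
      ContMDiffOn ((𝓡 1).prod (𝓡 n)) (𝓡 (n + 1)) ∞ e.toOpenPartialHomeomorph.symm e.target := by
  set B : Set Circle := (fun s => b * Circle.exp s) '' h.target with hB
  -- As `h.target` lies in `(-π, π)`, the argument of `b⁻¹ * c` is a smooth inverse on `B` of `s ↦ b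
  -- * Circle.exp s`.
  have hBo : IsOpen B := ((isOpenMap_mul_left b).comp
    isLocalHomeomorph_circleExp.isOpenMap) _ h.open_target
  set a : Circle → ℝ := fun c => Complex.arg (b⁻¹ * c : Circle) with ha
  have hab : ∀ s ∈ h.target, a (b * Circle.exp s) = s := fun s hs => by
    simp only [ha, inv_mul_cancel_left]
    exact Circle.arg_exp (hπ hs).1 (hπ hs).2.le
  have haB : ∀ c ∈ B, a c ∈ h.target ∧ b * Circle.exp (a c) = c := by
    rintro _ ⟨s, hs, rfl⟩
    rw [hab s hs]
    exact ⟨hs, rfl⟩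
  have hasm : ContMDiffOn (𝓡 1) 𝓘(ℝ, ℝ) ∞ a B :=
    Circle.contMDiffOn_arg.comp (Circle.contMDiff_mul_left b⁻¹).contMDiffOn fun c hc =>
      Circle.mem_slitPlane_of_arg_lt (hπ (haB c hc).1).2
  -- A fibre of `g` is a single leaf, and the fibre over a point of `B` contains a point of a slice
  -- of `Ψ`, so it is that slice.
  have hgB : ∀ x, g x ∈ B → ∃ s ∈ h.source, ∃ p, Ψ.map (s, p) = x := by
    intro x hx
    obtain ⟨p₀⟩ := Ψ.connectedSpace.toNonempty
    obtain ⟨hs, hc⟩ := haB _ hx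
    have h1 := hb _ (h.map_target hs) p₀
    rw [h.right_inv hs, hc, hgl, Ψ.leaf_map] at h1
    have h2 := V.mem_leaf x
    rw [← h1] at h2
    obtain ⟨p, hp⟩ := h2
    exact ⟨_, h.map_target hs, p, hp⟩
  have hrange : g ⁻¹' B ⊆ range Ψ.map := fun x hx => by
    obtain ⟨s, -, p, rfl⟩ := hgB x hx
    exact mem_range_self _
  have hinv : ContMDiffOn ((𝓡 1).prod (𝓡 n)) (𝓡 (n + 1)) ∞
      (fun z : Circle × F => Ψ.map (h.symm (a z.1), z.2)) (B ×ˢ univ) := by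
    refine Ψ.contMDiff_map.comp_contMDiffOn (ContMDiffOn.prodMk ?_ contMDiff_snd.contMDiffOn)
    refine (contMDiffOn_iff_contDiffOn.2 hh).comp
      (hasm.comp contMDiff_fst.contMDiffOn fun z hz => hz.1) fun z hz => (haB z.1 hz.1).1
  have hto : ContMDiffOn (𝓡 (n + 1)) ((𝓡 1).prod (𝓡 n)) ∞ (fun x => (g x, Ψ.proj x)) (g ⁻¹' B) :=
    hg.contMDiffOn.prodMk (Ψ.contMDiffOn_proj.mono hrange)
  have hmem : ∀ z : Circle × F, z.1 ∈ B → g (Ψ.map (h.symm (a z.1), z.2)) = z.1 := fun z hz => by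
    obtain ⟨hs, hc⟩ := haB _ hz
    rw [hb _ (h.map_target hs), h.right_inv hs, hc]
  refine ⟨
    { toFun := fun x => (g x, Ψ.proj x)
      invFun := fun z => Ψ.map (h.symm (a z.1), z.2)
      source := g ⁻¹' B
      target := B ×ˢ univ
      map_source' := fun x hx => ⟨hx, trivial⟩
      map_target' := fun z hz => by
        rw [mem_preimage, hmem z hz.1]
        exact hz.1
      left_inv' := fun x hx => ?_
      right_inv' := fun z hz => by rw [hmem z hz.1, Ψ.proj_map]
      open_source := hBo.preimage hg.continuous
      open_target := hBo.prod isOpen_univ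
      continuousOn_toFun := hto.continuousOn
      continuousOn_invFun := hinv.continuousOn
      baseSet := B
      open_baseSet := hBo
      source_eq := rfl
      target_eq := rfl
      proj_toFun := fun _ _ => rfl }, rfl, hto, hinv⟩
  obtain ⟨s, hs, p, rfl⟩ := hgB x hx
  simp only [hb s hs p, hab _ (h.map_source hs), h.left_inv hs, Ψ.proj_map]

end CodimOneFoliation

/-! ### The theorem -/

theorem lemma1 (n : ℕ) (M : Type u) [TopologicalSpace M] [T2Space M] [CompactSpace M]
    [ConnectedSpace M] [ChartedSpace (EuclideanSpace ℝ (Fin (n + 1))) M]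
    [IsManifold (𝓡 (n + 1)) ∞ M] (V : CodimOneFoliation n M)
    (hV : V.TransversallyOrientable) (hdich : V.DichotomyProperty)
    (hL : ∃ L, V.IsCompactLeaf L ∧ ∃ U ∈ 𝓝ˢ L, V.OptionTwo L U) :
    (∀ L, V.IsLeaf L → V.IsCompactLeaf L) ∧
      ∃ π : M → Circle, IsSmoothBundleOverCircle n π ∧
        ∀ L : Set M, V.IsLeaf L ↔ ∃ c : Circle, L = π ⁻¹' {c} := by
  obtain ⟨L₀, ⟨⟨x, hx⟩, -⟩, U, -, -, hL₀⟩ := hL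
  obtain ⟨_, _, Φ₀, -⟩ := hL₀.exists_leafProduct ⟨x, hx ▸ V.mem_leaf x⟩
  have hF := hdich.exists_leafProduct Φ₀
  refine ⟨?_, ?_⟩
  · rintro _ ⟨y, rfl⟩
    obtain ⟨Φ, hΦ⟩ := hF y
    exact Φ.isCompactLeaf_leaf hΦ
  obtain ⟨f, hf, hfl⟩ := hV.exists_submersion hF
  obtain ⟨m, g, hm, hgc, hgs, hgl, hgm⟩ :=
    CodimOneFoliation.exists_root_of_submersion hF hf hfl
  have hm' : (0 : ℝ) < m := by exact_mod_cast hm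
  -- So far `g` is only continuous. Dividing a local logarithm of `f` by `m` gives a smooth root of
  -- `f` that agrees with `g` at `x₀`, hence near it; `O` is shrunk so that the values lie in `(-π,
  -- π)`.
  have hloc : ∀ x₀, ∃ (Ψ : V.LeafProduct L₀) (t₀ : ℝ) (p₀ : L₀) (O : Set M) (v : M → ℝ),
      Ψ.map (t₀, p₀) = x₀ ∧ IsOpen O ∧ x₀ ∈ O ∧ ContMDiffOn (𝓡 (n + 1)) 𝓘(ℝ, ℝ) ∞ v O ∧
      (∀ x ∈ O, v x ∈ Ioo (-Real.pi) Real.pi ∧ g x = g x₀ * Circle.exp (v x)) ∧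
      ∀ t p, Ψ.map (t, p) ∈ O → 0 < deriv (fun s => v (Ψ.map (s, p))) t := by
    intro x₀
    obtain ⟨Ψ, t₀, p₀, O, v, hx₀, hO, hx₀O, hv, hv0, hfv, hd⟩ := hfl x₀
    have hv' : ContMDiffOn (𝓡 (n + 1)) 𝓘(ℝ, ℝ) ∞ (fun x => v x / m) O := by
      have h1 : ContMDiff 𝓘(ℝ, ℝ) 𝓘(ℝ, ℝ) ∞ fun s : ℝ => s / m := by
        rw [contMDiff_iff_contDiff]
        fun_prop
      exact h1.comp_contMDiffOn hv
    have hvc : ContinuousAt (fun x => v x / m) x₀ :=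
      hv'.continuousOn.continuousAt (hO.mem_nhds hx₀O)
    have h1 : ∀ᶠ x in 𝓝 x₀, g x = g x₀ * Circle.exp (v x / m) := by
      refine Circle.eventually_eq_of_pow_eq hgc.continuousAt
        (continuousAt_const.mul (Circle.exp.continuous.continuousAt.comp hvc)) ?_ hm ?_
      · simp [hv0]
      · filter_upwards [hO.mem_nhds hx₀O] with x hx
        rw [mul_pow, hgm, hgm, hfv x hx, ← Circle.exp_nsmul, nsmul_eq_mul,
          mul_div_cancel₀ _ hm'.ne']
    have h2 : ∀ᶠ x in 𝓝 x₀, v x / m ∈ Ioo (-Real.pi) Real.pi := by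
      refine hvc.eventually (isOpen_Ioo.mem_nhds ?_)
      simp only [hv0, zero_div]
      exact ⟨by linarith [Real.pi_pos], Real.pi_pos⟩
    obtain ⟨O', hO'sub, hO', hx₀O'⟩ := eventually_nhds_iff.1 (h2.and h1)
    refine ⟨Ψ, t₀, p₀, O ∩ O', fun x => v x / m, hx₀, hO.inter hO', ⟨hx₀O, hx₀O'⟩,
      hv'.mono inter_subset_left, fun x hx => hO'sub x hx.2, fun t p ht => ?_⟩
    rw [deriv_div_const]
    exact div_pos (hd t p ht.1) hm'
  have hgsm : ContMDiff (𝓡 (n + 1)) (𝓡 1) ∞ g := by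
    intro x₀
    obtain ⟨-, -, -, O, v, -, hO, hx₀, hv, hgv, -⟩ := hloc x₀
    have h1 : ContMDiffAt (𝓡 (n + 1)) (𝓡 1) ∞ (fun x => g x₀ * Circle.exp (v x)) x₀ :=
      ((Circle.contMDiff_mul_left (g x₀)).comp contMDiff_circleExp).contMDiffAt.comp x₀
        (hv.contMDiffAt (hO.mem_nhds hx₀))
    refine h1.congr_of_eventuallyEq ?_
    filter_upwards [hO.mem_nhds hx₀] with x hx using (hgv x hx).2
  have hleaf : ∀ y, V.leaf y = g ⁻¹' {g y} := by
    intro y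
    ext z
    rw [mem_preimage, mem_singleton_iff, hgl]
    exact ⟨fun h => (V.leaf_eq h).symm, fun h => h ▸ V.mem_leaf z⟩
  refine ⟨g, ⟨hgsm, L₀, inferInstance, inferInstance, inferInstance, fun b => ?_⟩, fun L => ?_⟩
  · obtain ⟨x₀, rfl⟩ := hgs b
    obtain ⟨Ψ, t₀, p₀, O, v, hx₀, hO, hx₀O, hv, hgv, hd⟩ := hloc x₀
    obtain ⟨h, ht₀, hhO, hhv, -, hh⟩ := Ψ.exists_coordinate hO hv (hx₀ ▸ hx₀O) hd
    obtain ⟨e, heB, he1, he2⟩ := Ψ.exists_trivialization hgsm hgl hh (b := g x₀)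
      (fun s hs => by
        have h1 := hhO _ (h.map_target hs)
        rw [← h.right_inv hs, hhv]
        exact (hgv _ h1).1)
      (fun s hs p => by
        rw [hhv, ← (hgv _ (hhO s hs)).2, hgl, Ψ.leaf_map, Ψ.leaf_map])
    refine ⟨e, ?_, he1, he2⟩
    rw [heB]
    refine ⟨h t₀, h.map_source ht₀, ?_⟩
    simp only [hhv]
    rw [← (hgv _ (hhO _ ht₀)).2, hx₀]
  · constructor
    · rintro ⟨y, rfl⟩
      exact ⟨g y, hleaf y⟩
    · rintro ⟨c, rfl⟩
      obtain ⟨y, rfl⟩ := hgs c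
      exact ⟨y, (hleaf y).symm⟩
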